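/- All representations are finite-dimensional over $\mathbb{Q}$. For a partition $\mu$ of $n$ let $V_\mu$ be the corresponding irreducible representation of $S_n$ (the Specht module, spanned by the polytabloids of shape $\mu$). For a partition $\lambda=(\lambda_1\ge\lambda_2\ge\cdots)$ of $|\lambda|$ and $n\ge|\lambda|+\lambda_1$ put $\lambda[n]=(n-|\lambda|,\lambda_1,\lambda_2,\dots)$ and $V(\lambda)_n=V_{\lambda[n]}$. Identify $S_n$ with the subgroup of $S_{n+1}$ fixing $n+1$. A consistent sequence consists of representations $V_n$ of $S_n$ and linear maps $\phi_n\colon V_n\to V_{n+1}$ with $\phi_n(\sigma v)=\sigma\phi_n(v)$ for $\sigma\in S_n$. The sequence is monotone for $n\ge N$ if for every $n\ge N$, every $\lambda$ for which $V(\lambda)_n$ is defined, every $m\ge 0$ and every subrepresentation $W\le V_n$ isomorphic to $V(\lambda)_n^{\oplus m}$, the $S_{n+1}$-span of $\phi_n(W)$ contains a subrepresentation isomorphic to $V(\lambda)_{n+1}^{\oplus m}$. It is uniformly representation stable with stable range $n\ge N$ if for all $n\ge N$ the map $\phi_n$ is injective and the $S_{n+1}$-span of $\phi_n(V_n)$ is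 $V_{n+1}$, and if for every partition $\lambda$ the multiplicity of $V(\lambda)_n$ in $V_n$ (taken to be $0$ when $V(\lambda)_n$ is not defined) is finite and independent of $n$ for $n\ge N$. Theorem. Let $k\ge 0$ and let $V$ be a finite-dimensional rational representation of $S_k$. For $n\ge k$ let $I_n(V)=\operatorname{Ind}_{S_k\times S_{n-k}}^{S_n}(V\boxtimes\mathbb{Q})$, where $S_{n-k}$ acts trivially on $V\boxtimes\mathbb Q$, and let $\iota_n\colon I_n(V)\to I_{n+1}(V)$ be the natural $S_n$-equivariant map, which sends the class of $\sigma\otimes v$ ($\sigma\in S_n$, $v\in V$) to the class of $\sigma\otimes v$ with $\sigma$ regarded as an element of $S_{n+1}$. Then the consistent sequence $(I_n(V),\iota_n)_{n\ge k}$ is monotone for $n\ge k$ and uniformly representation stable with stable range $n\ge 2k$. -/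

import Mathlib

universe u

namespace RepStability

open scoped MonoidAlgebra

/-! ### Symmetric groups and the standard embeddings -/

/-- The embedding `S_k × S_ℓ → S_{k+ℓ}`: the first factor permutes the first `k` letters, the
second factor permutes the last `ℓ` letters. -/
def youngHom (k ℓ : ℕ) :
    Equiv.Perm (Fin k) × Equiv.Perm (Fin ℓ) →* Equiv.Perm (Fin (k + ℓ)) :=
  (finSumFinEquiv.permCongrHom.toMonoidHom).comp (Equiv.Perm.sumCongrHom (Fin k) (Fin ℓ))

/-- The standard embedding `S_n → S_{n+1}`, whose image fixes the last letter. -/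
def stdHom (n : ℕ) : Equiv.Perm (Fin n) →* Equiv.Perm (Fin (n + 1)) :=
  (youngHom n 1).comp (MonoidHom.inl _ _)

theorem youngHom_castAdd {k ℓ : ℕ} (g : Equiv.Perm (Fin k) × Equiv.Perm (Fin ℓ)) (i : Fin k) :
    youngHom k ℓ g (Fin.castAdd ℓ i) = Fin.castAdd ℓ (g.1 i) := by
  simp [youngHom, Equiv.permCongrHom]

theorem youngHom_natAdd {k ℓ : ℕ} (g : Equiv.Perm (Fin k) × Equiv.Perm (Fin ℓ)) (i : Fin ℓ) :
    youngHom k ℓ g (Fin.natAdd k i) = Fin.natAdd k (g.2 i) := by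
  simp [youngHom, Equiv.permCongrHom]

theorem stdHom_castSucc {n : ℕ} (σ : Equiv.Perm (Fin n)) (i : Fin n) :
    stdHom n σ i.castSucc = (σ i).castSucc :=
  youngHom_castAdd (σ, 1) i

theorem stdHom_last {n : ℕ} (σ : Equiv.Perm (Fin n)) :
    stdHom n σ (Fin.last n) = Fin.last n :=
  youngHom_natAdd (σ, 1) (0 : Fin 1)

theorem youngHom_stdHom {k ℓ : ℕ} (g : Equiv.Perm (Fin k) × Equiv.Perm (Fin ℓ)) :
    youngHom k (ℓ + 1) (g.1, stdHom ℓ g.2) = stdHom (k + ℓ) (youngHom k ℓ g) := by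
  ext x
  congr 1
  induction x using Fin.lastCases with
  | last =>
    have h := youngHom_natAdd (g.1, stdHom ℓ g.2) (Fin.last ℓ)
    rw [stdHom_last] at h
    exact h.trans (stdHom_last (youngHom k ℓ g)).symm
  | cast x =>
    refine Eq.trans ?_ (stdHom_castSucc _ _).symm
    induction x using Fin.addCases with
    | left i =>
      rw [youngHom_castAdd]
      exact youngHom_castAdd (g.1, stdHom ℓ g.2) i
    | right i =>
      rw [youngHom_natAdd]
      have h := youngHom_natAdd (g.1, stdHom ℓ g.2) i.castSucc
      rw [stdHom_castSucc] at h
      exact h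

/-! ### Irreducible representations of `S_n` through polytabloids -/

/-- A tableau of shape `μ`: a bijective labelling of the boxes of `μ` by `Fin n`.
A box is a pair (row, column). -/
abbrev Tableau (μ : YoungDiagram) (n : ℕ) : Type := μ.cells ≃ Fin n

namespace Tableau

variable {μ : YoungDiagram} {n : ℕ}

/-- The row of the box with label `x`. -/
def rowOf (T : Tableau μ n) (x : Fin n) : ℕ := (T.symm x).1.1

/-- The column of the box with label `x`. -/
def colOf (T : Tableau μ n) (x : Fin n) : ℕ := (T.symm x).1.2

/-- `S_n` acts on tableaux by permuting the labels. -/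
instance : MulAction (Equiv.Perm (Fin n)) (Tableau μ n) where
  smul σ T := T.trans σ
  one_smul _ := rfl
  mul_smul _ _ _ := rfl

theorem smul_apply (σ : Equiv.Perm (Fin n)) (T : Tableau μ n) (c : μ.cells) :
    (σ • T) c = σ (T c) := rfl

theorem rowOf_smul (σ : Equiv.Perm (Fin n)) (T : Tableau μ n) (x : Fin n) :
    (σ • T).rowOf x = T.rowOf (σ⁻¹ x) := rfl

theorem colOf_smul (σ : Equiv.Perm (Fin n)) (T : Tableau μ n) (x : Fin n) :
    (σ • T).colOf x = T.colOf (σ⁻¹ x) := rfl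

/-- Two tableaux are row equivalent if they differ by reordering the labels within each row,
that is, if every label lies in the same row of both. -/
def rowSetoid (μ : YoungDiagram) (n : ℕ) : Setoid (Tableau μ n) where
  r T T' := ∀ x, T.rowOf x = T'.rowOf x
  iseqv := ⟨fun _ _ => rfl, fun h x => (h x).symm, fun h h' x => (h x).trans (h' x)⟩

/-- The column stabilizer of `T`: the permutations that preserve the set of entries of each
column of `T`. -/
def colStab (T : Tableau μ n) : Subgroup (Equiv.Perm (Fin n)) where
  carrier := {q | ∀ x, T.colOf (q x) = T.colOf x}
  one_mem' _ := rfl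
  mul_mem' {p q} hp hq x := (hp (q x)).trans (hq x)
  inv_mem' {q} hq x := by simpa using (hq (q⁻¹ x)).symm

instance (T : Tableau μ n) : DecidablePred (· ∈ T.colStab) := fun q =>
  inferInstanceAs (Decidable (∀ x, T.colOf (q x) = T.colOf x))

theorem mem_colStab {T : Tableau μ n} {q : Equiv.Perm (Fin n)} :
    q ∈ T.colStab ↔ ∀ x, T.colOf (q x) = T.colOf x := Iff.rfl

end Tableau

/-- Tabloids of shape `μ`: tableaux up to reordering within the rows. -/
def Tabloid (μ : YoungDiagram) (n : ℕ) : Type := Quotient (Tableau.rowSetoid μ n)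

/-- The tabloid of a tableau. -/
def Tabloid.mk {μ : YoungDiagram} {n : ℕ} (T : Tableau μ n) : Tabloid μ n :=
  Quotient.mk (Tableau.rowSetoid μ n) T

instance (μ : YoungDiagram) (n : ℕ) : MulAction (Equiv.Perm (Fin n)) (Tabloid μ n) where
  smul σ := Quotient.map (σ • ·) fun _ _ h x => h (σ⁻¹ x)
  one_smul t := by induction t using Quotient.inductionOn with | h T => rfl
  mul_smul σ τ t := by induction t using Quotient.inductionOn with | h T => rfl

theorem Tabloid.smul_mk {μ : YoungDiagram} {n : ℕ} (σ : Equiv.Perm (Fin n)) (T : Tableau μ n) :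
    σ • Tabloid.mk T = Tabloid.mk (σ • T) := rfl

/-- The permutation representation `M^μ` of `S_n`, with basis the tabloids of shape `μ`. -/
noncomputable abbrev tabloidRep (μ : YoungDiagram) (n : ℕ) :
    Representation ℚ (Equiv.Perm (Fin n)) ℚ[Tabloid μ n] :=
  Representation.ofMulAction ℚ (Equiv.Perm (Fin n)) (Tabloid μ n)

/-- The polytabloid `v_T = ∑_{q ∈ ColStab T} sign(q) {qT}`. -/
noncomputable def polytabloid {μ : YoungDiagram} {n : ℕ} (T : Tableau μ n) : ℚ[Tabloid μ n] :=
  ∑ q : T.colStab,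
    MonoidAlgebra.single (Tabloid.mk ((q : Equiv.Perm (Fin n)) • T))
      ((Equiv.Perm.sign (q : Equiv.Perm (Fin n)) : ℤ) : ℚ)

theorem tabloidRep_polytabloid {μ : YoungDiagram} {n : ℕ} (σ : Equiv.Perm (Fin n))
    (T : Tableau μ n) : tabloidRep μ n σ (polytabloid T) = polytabloid (σ • T) := by
  have hmem : ∀ q : Equiv.Perm (Fin n), q ∈ T.colStab ↔ σ * q * σ⁻¹ ∈ (σ • T).colStab := by
    intro q
    simp only [Tableau.mem_colStab, Tableau.colOf_smul]
    refine ⟨fun h x => ?_, fun h x => ?_⟩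
    · simpa using h (σ⁻¹ x)
    · simpa using h (σ x)
  unfold polytabloid
  rw [map_sum]
  refine Fintype.sum_equiv
    ((MulAut.conj σ).toEquiv.subtypeEquiv (p := (· ∈ T.colStab)) (q := (· ∈ (σ • T).colStab))
      hmem) _ _ fun q => ?_
  rw [Representation.ofMulAction_single, Tabloid.smul_mk]
  have h1 : (((MulAut.conj σ).toEquiv.subtypeEquiv (p := (· ∈ T.colStab))
      (q := (· ∈ (σ • T).colStab)) hmem q : (σ • T).colStab) : Equiv.Perm (Fin n)) =
      σ * q * σ⁻¹ := rfl
  rw [h1, smul_smul, smul_smul]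
  congr 1
  · simp
  · rw [map_mul, map_mul, Equiv.Perm.sign_inv, mul_comm (Equiv.Perm.sign σ), mul_assoc,
      Int.units_mul_self, mul_one]

/-- The Specht module of shape `μ` (for `μ` with `n` boxes, the irreducible representation `V_μ`
of `S_n`): the span in `M^μ` of all polytabloids of shape `μ`. -/
noncomputable def specht (μ : YoungDiagram) (n : ℕ) : Subrepresentation (tabloidRep μ n) where
  toSubmodule := Submodule.span ℚ (Set.range polytabloid)
  apply_mem_toSubmodule σ v hv := by
    have h : Submodule.span ℚ (Set.range polytabloid) ≤
        (Submodule.span ℚ (Set.range (polytabloid (μ := μ) (n := n)))).comap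
          (tabloidRep μ n σ) := by
      rw [Submodule.span_le]
      rintro _ ⟨T, rfl⟩
      exact Submodule.subset_span ⟨σ • T, (tabloidRep_polytabloid σ T).symm⟩
    exact h hv

/-- The condition `n ≥ |lam| + lam_1`, under which `lam[n]` and `V(lam)_n` are defined. -/
def IsPaddable (lam : YoungDiagram) (n : ℕ) : Prop := lam.card + lam.rowLen 0 ≤ n

theorem IsPaddable.succ {lam : YoungDiagram} {n : ℕ} (h : IsPaddable lam n) :
    IsPaddable lam (n + 1) :=
  Nat.le_succ_of_le h

/-- The partition `lam[n] = (n - |lam|, lam_1, lam_2, …)` of `n`. -/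
def padded (lam : YoungDiagram) (n : ℕ) (h : IsPaddable lam n) : YoungDiagram :=
  YoungDiagram.ofRowLens ((n - lam.card) :: lam.rowLens) <| by
    rw [List.sortedGE_iff_pairwise, List.pairwise_cons]
    refine ⟨fun x hx => ?_, lam.rowLens_sorted.pairwise⟩
    rw [YoungDiagram.rowLens, List.mem_map] at hx
    obtain ⟨i, -, rfl⟩ := hx
    have h1 := lam.rowLen_anti 0 i (Nat.zero_le i)
    unfold IsPaddable at h
    change lam.rowLen i ≤ n - lam.card
    omega

/-- The irreducible representation `V(lam)_n = V_{lam[n]}` of `S_n`. -/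
noncomputable def stableIrrep (lam : YoungDiagram) (n : ℕ) (h : IsPaddable lam n) :
    Representation ℚ (Equiv.Perm (Fin n)) (specht (padded lam n h) n).toSubmodule :=
  (specht (padded lam n h) n).toRepresentation

/-! ### Isotypic subrepresentations, multiplicities, spans -/

section General

variable {G : Type*} [Group G] {U V : Type*} [AddCommGroup U] [Module ℚ U] [AddCommGroup V]
  [Module ℚ V]

/-- `W ≅ U^{⊕ m}` as representations, for a subrepresentation `W`. -/
def IsCopies {ρ : Representation ℚ G V} (W : Subrepresentation ρ) (τ : Representation ℚ G U)
    (m : ℕ) : Prop :=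
  Nonempty (W.toRepresentation.Equiv (Representation.directSum fun _ : Fin m => τ))

/-- The multiplicity of an irreducible representation `τ` in `ρ`: the supremum of all `m` such
that `ρ` has a subrepresentation isomorphic to `τ^{⊕ m}`. -/
noncomputable def multiplicity (τ : Representation ℚ G U) (ρ : Representation ℚ G V) : ℕ∞ :=
  sSup {c : ℕ∞ | ∃ m : ℕ, c = m ∧ ∃ W : Subrepresentation ρ, IsCopies W τ m}

/-- The `G`-span of a subset `S` of a representation. -/
def groupSpan (ρ : Representation ℚ G V) (S : Set V) : Subrepresentation ρ where
  toSubmodule := Submodule.span ℚ {v | ∃ g : G, ∃ s ∈ S, v = ρ g s}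
  apply_mem_toSubmodule g v hv := by
    have h : Submodule.span ℚ {v | ∃ g : G, ∃ s ∈ S, v = ρ g s} ≤
        (Submodule.span ℚ {v | ∃ g : G, ∃ s ∈ S, v = ρ g s}).comap (ρ g) := by
      rw [Submodule.span_le]
      rintro _ ⟨g', s, hs, rfl⟩
      exact Submodule.subset_span ⟨g * g', s, hs, by rw [map_mul]; rfl⟩
    exact h hv

end General

/-! ### Consistent sequences, representation stability, monotonicity -/

/-- A consistent sequence `V_k → V_{k+1} → V_{k+2} → ⋯` of finite-dimensional rational
representations of `S_k, S_{k+1}, S_{k+2}, …`. The term of index `ℓ` is `V_n` for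
`n = k + ℓ`. -/
structure ConsistentSequence (k : ℕ) where
  /-- The vector space `V_{k+ℓ}`. -/
  V : ℕ → Type u
  [addCommGroup : ∀ ℓ, AddCommGroup (V ℓ)]
  [module : ∀ ℓ, Module ℚ (V ℓ)]
  [finiteDimensional : ∀ ℓ, FiniteDimensional ℚ (V ℓ)]
  /-- The action of `S_{k+ℓ}` on `V_{k+ℓ}`. -/
  ρ : ∀ ℓ, Representation ℚ (Equiv.Perm (Fin (k + ℓ))) (V ℓ)
  /-- The map `V_{k+ℓ} → V_{k+ℓ+1}`. -/
  φ : ∀ ℓ, V ℓ →ₗ[ℚ] V (ℓ + 1)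
  equivariant : ∀ ℓ (σ : Equiv.Perm (Fin (k + ℓ))) (v : V ℓ),
    φ ℓ (ρ ℓ σ v) = ρ (ℓ + 1) (stdHom (k + ℓ) σ) (φ ℓ v)

namespace ConsistentSequence

attribute [instance] addCommGroup module finiteDimensional

variable {k : ℕ} (S : ConsistentSequence.{u} k)

open Classical in
/-- The multiplicity `c_lam(V_n)` of `V(lam)_n` in `V_n`, for `n = k + ℓ`; it is zero if
`V(lam)_n` is not defined. -/
noncomputable def mult (lam : YoungDiagram) (ℓ : ℕ) : ℕ∞ :=
  if h : IsPaddable lam (k + ℓ) then multiplicity (stableIrrep lam (k + ℓ) h) (S.ρ ℓ) else 0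

/-- The `S_{n+1}`-span of the image under `φ_n` of a subspace `W` of `V_n`, for `n = k + ℓ`. -/
noncomputable def spanImage (ℓ : ℕ) (W : Submodule ℚ (S.V ℓ)) :
    Subrepresentation (S.ρ (ℓ + 1)) :=
  groupSpan (S.ρ (ℓ + 1)) (S.φ ℓ '' (W : Set (S.V ℓ)))

/-- Monotonicity for `n ≥ N`: for each `n ≥ N`, if `W` is a subrepresentation of `V_n` isomorphic
to `V(lam)_n^{⊕ m}`, then the `S_{n+1}`-span of `φ_n(W)` contains a subrepresentation isomorphic
to `V(lam)_{n+1}^{⊕ m}`. -/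
def IsMonotone (N : ℕ) : Prop :=
  ∀ ℓ : ℕ, N ≤ k + ℓ →
    ∀ (lam : YoungDiagram) (h : IsPaddable lam (k + ℓ)) (m : ℕ)
      (W : Subrepresentation (S.ρ ℓ)),
      IsCopies W (stableIrrep lam (k + ℓ) h) m →
        ∃ U : Subrepresentation (S.ρ (ℓ + 1)),
          U ≤ S.spanImage ℓ W.toSubmodule ∧
            IsCopies U (stableIrrep lam (k + (ℓ + 1)) h.succ) m

/-- Uniform representation stability with stable range `n ≥ N`. -/
structure IsUniformlyRepresentationStable (N : ℕ) : Prop where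
  injectivity : ∀ ℓ, N ≤ k + ℓ → Function.Injective (S.φ ℓ)
  surjectivity : ∀ ℓ, N ≤ k + ℓ → (S.spanImage ℓ ⊤).toSubmodule = ⊤
  multiplicity_stable : ∀ lam : YoungDiagram, ∃ c : ℕ, ∀ ℓ, N ≤ k + ℓ → S.mult lam ℓ = c

end ConsistentSequence

/-! ### The sequence of induced representations -/

section Induced

variable {k : ℕ} {V : Type u} [AddCommGroup V] [Module ℚ V]
  (ρ : Representation ℚ (Equiv.Perm (Fin k)) V)

/-- The representation `V ⊠ ℚ` of `S_k × S_ℓ`: the space `V`, on which `S_ℓ` acts trivially. -/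
abbrev boxTrivial (ℓ : ℕ) : Representation ℚ (Equiv.Perm (Fin k) × Equiv.Perm (Fin ℓ)) V :=
  ρ.comp (MonoidHom.fst _ _)

/-- The space of `I_{k+ℓ}(V) = Ind_{S_k × S_ℓ}^{S_{k+ℓ}} (V ⊠ ℚ)`. -/
abbrev IndSpace (ℓ : ℕ) : Type u := Representation.IndV (youngHom k ℓ) (boxTrivial ρ ℓ)

/-- The representation `I_{k+ℓ}(V) = Ind_{S_k × S_ℓ}^{S_{k+ℓ}} (V ⊠ ℚ)` of `S_{k+ℓ}`. -/
noncomputable abbrev indRep (ℓ : ℕ) :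
    Representation ℚ (Equiv.Perm (Fin (k + ℓ))) (IndSpace ρ ℓ) :=
  Representation.ind (youngHom k ℓ) (boxTrivial ρ ℓ)

/-- The natural map `ι_n : I_n(V) → I_{n+1}(V)` for `n = k + ℓ`. It sends the class of `σ ⊗ v` to
the class of `σ ⊗ v`, where on the right `σ ∈ S_n` is regarded as an element of `S_{n+1}`. -/
noncomputable def indInclusion (ℓ : ℕ) : IndSpace ρ ℓ →ₗ[ℚ] IndSpace ρ (ℓ + 1) :=
  Representation.Coinvariants.lift _
    (Representation.Coinvariants.mk _ ∘ₗ
      (MonoidAlgebra.mapDomainLinearMap ℚ ℚ (stdHom (k + ℓ))).rTensor V) <| by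
    intro g
    ext σ v
    have h := youngHom_stdHom g
    have key := Representation.Coinvariants.mk_self_apply
      (Representation.tprod ((Representation.leftRegular ℚ
        (Equiv.Perm (Fin (k + (ℓ + 1))))).comp (youngHom k (ℓ + 1))) (boxTrivial ρ (ℓ + 1)))
      (g.1, stdHom ℓ g.2)
      (TensorProduct.tmul ℚ (MonoidAlgebra.single (stdHom (k + ℓ) σ) (1 : ℚ)) v)
    rw [Representation.tprod_apply, TensorProduct.map_tmul, MonoidHom.comp_apply, h,
      Representation.ofMulAction_single, smul_eq_mul, ← map_mul] at key
    simpa using key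

theorem indInclusion_mk (ℓ : ℕ) (σ : Equiv.Perm (Fin (k + ℓ))) (v : V) :
    indInclusion ρ ℓ (Representation.IndV.mk (youngHom k ℓ) (boxTrivial ρ ℓ) σ v) =
      Representation.IndV.mk (youngHom k (ℓ + 1)) (boxTrivial ρ (ℓ + 1))
        (stdHom (k + ℓ) σ) v := by
  simp [indInclusion]

theorem indInclusion_equivariant (ℓ : ℕ) (σ : Equiv.Perm (Fin (k + ℓ))) (x : IndSpace ρ ℓ) :
    indInclusion ρ ℓ (indRep ρ ℓ σ x) =
      indRep ρ (ℓ + 1) (stdHom (k + ℓ) σ) (indInclusion ρ ℓ x) := by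
  have h : indInclusion ρ ℓ ∘ₗ indRep ρ ℓ σ =
      indRep ρ (ℓ + 1) (stdHom (k + ℓ) σ) ∘ₗ indInclusion ρ ℓ := by
    refine Representation.IndV.hom_ext _ _ fun τ => LinearMap.ext fun v => ?_
    change indInclusion ρ ℓ (indRep ρ ℓ σ (Representation.IndV.mk _ _ τ v)) =
      indRep ρ (ℓ + 1) (stdHom (k + ℓ) σ) (indInclusion ρ ℓ (Representation.IndV.mk _ _ τ v))
    rw [indInclusion_mk, Representation.ind_mk, indInclusion_mk, map_mul, map_inv]
    exact (Representation.ind_mk (youngHom k (ℓ + 1)) (boxTrivial ρ (ℓ + 1)) _ _ _).symm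
  exact LinearMap.congr_fun h x

/-- The consistent sequence `I_n(V) = Ind_{S_k × S_{n-k}}^{S_n} (V ⊠ ℚ)`, `n ≥ k`, with the
natural inclusions. -/
noncomputable def inducedSequence [FiniteDimensional ℚ V] : ConsistentSequence.{u} k where
  V := IndSpace ρ
  finiteDimensional := fun _ => inferInstance
  ρ := indRep ρ
  φ := indInclusion ρ
  equivariant := indInclusion_equivariant ρ

end Induced

end RepStability

/-!
Frobenius reciprocity turns maps `f : V(lam)_n → I_n(V)` into maps `ψ : V(lam)_n → V` that are
equivariant for `S_k × S_{n-k}`, where `ψ` is the projection of `f` to the trivial coset. As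
`V(lam)_n` is absolutely irreducible, its multiplicity is the dimension of the space of these
maps, and linearly independent maps span a direct sum of copies of `V(lam)_n`. Two injections
compare the spaces for `n` and `n+1`.

From `n` to `n+1`, let the tableau `T'` arise from a tableau `T` of shape `lam[n]` by putting
`n+1` into a new column of height one, and let `R'`, `C'` be the row and column symmetrizers of
`T'`. Sending `f` to the map with `v_{T'} ↦ C' R' ι_n(f(v_T))` keeps the image inside the span of
`ι_n(f(V(lam)_n))`. Positivity of an invariant form and `C' ι_n(f(v_T)) = |C| ι_n(f(v_T))` reduce
injectivity to that of `∑ (i n+1) ι_n` over the letters `i` of the first row, `i = n+1` included;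
there, the component at each coset is a positive multiple of the component of the argument. This
proves monotonicity.

From `n+1` to `n`, restrict `ψ` along the map `V(lam)_n → V(lam)_{n+1}` with `v_T ↦ v_{T'}`. As
`ψ` is invariant under `S_{n+1-k}`, it vanishes on `v_S` as soon as two of the letters after the
first `k` share a column of `S`. When they do not, and `n ≥ k + lam_1`, one of them is alone in its
column and may be assumed to be `n+1` in the new box, so `v_S` is in the image of `V(lam)_n`. Hence
restriction is injective for `n ≥ k + lam_1`. If `|lam| > k`, there are more than `n - |lam|`
letters after the first `k` and only `n - |lam|` columns, so `ψ = 0`.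
-/

namespace RepStability

open Module Representation
open scoped MonoidAlgebra

section Symmetrizer

variable {k G V W : Type*} [CommRing k] [Group G] [AddCommGroup V] [Module k V]
  [AddCommGroup W] [Module k W] (ρ : Representation k G V) {σ : Representation k G W}
  (H : Subgroup G) [Fintype H] (χ : G →* ℤˣ)

/-- The operator `∑_{h ∈ H} χ(h) h` on a representation of `G`, for a subgroup `H` and a sign
character `χ`. The trivial character and the sign give the row and column symmetrizers of a
tableau. -/
def symmetrizer : V →ₗ[k] V := ∑ h : H, χ h • ρ h

theorem symmetrizer_apply (x : V) : symmetrizer ρ H χ x = ∑ h : H, χ h • ρ h x := by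
  simp only [symmetrizer, LinearMap.sum_apply, LinearMap.smul_apply]

variable {ρ} in
theorem map_symmetrizer (f : IntertwiningMap ρ σ) (x : V) :
    f (symmetrizer ρ H χ x) = symmetrizer σ H χ (f x) := by
  simp only [symmetrizer_apply, map_sum, Units.smul_def, map_zsmul, f.isIntertwining]

theorem symmetrizer_mem (Y : Subrepresentation ρ) {x : V} (hx : x ∈ Y) :
    symmetrizer ρ H χ x ∈ Y := by
  rw [symmetrizer_apply]
  exact Submodule.sum_mem Y.toSubmodule fun h _ =>
    zsmul_mem (S := Submodule k V) (Y.apply_mem_toSubmodule _ hx) _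

variable {H}

theorem symmetrizer_apply_of_mem {h : G} (hh : h ∈ H) (x : V) :
    symmetrizer ρ H χ (ρ h x) = χ h • symmetrizer ρ H χ x := by
  rw [symmetrizer_apply, symmetrizer_apply, Finset.smul_sum]
  refine Fintype.sum_equiv (Equiv.mulRight (⟨h, hh⟩ : H)) _ _ fun g => ?_
  rw [Equiv.coe_mulRight, Subgroup.coe_mul, map_mul, map_mul, Module.End.mul_apply, smul_smul,
    mul_comm (χ g), ← mul_assoc, Int.units_mul_self, one_mul]

theorem apply_symmetrizer_of_mem {h : G} (hh : h ∈ H) (x : V) :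
    ρ h (symmetrizer ρ H χ x) = χ h • symmetrizer ρ H χ x := by
  rw [symmetrizer_apply, map_sum, Finset.smul_sum]
  refine Fintype.sum_equiv (Equiv.mulLeft (⟨h, hh⟩ : H)) _ _ fun g => ?_
  rw [Equiv.coe_mulLeft, Subgroup.coe_mul, map_mul, map_mul, Module.End.mul_apply, smul_smul,
    ← mul_assoc, Int.units_mul_self, one_mul, Units.smul_def, Units.smul_def, map_zsmul]

theorem symmetrizer_symmetrizer (x : V) :
    symmetrizer ρ H χ (symmetrizer ρ H χ x) = Fintype.card H • symmetrizer ρ H χ x := by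
  rw [symmetrizer_apply ρ H χ (symmetrizer ρ H χ x), ← Finset.card_univ, ← Finset.sum_const]
  refine Finset.sum_congr rfl fun h _ => ?_
  rw [apply_symmetrizer_of_mem ρ χ h.2, smul_smul, Int.units_mul_self, one_smul]

end Symmetrizer

section InvariantForm

variable {k G V : Type*} [Field k] [Group G] [AddCommGroup V] [Module k V]

theorem exists_invariant_anisotropic_form [LinearOrder k] [IsStrictOrderedRing k] [Finite G]
    [FiniteDimensional k V] (ρ : Representation k G V) :
    ∃ B : LinearMap.BilinForm k V,
      (∀ g x y, B (ρ g x) (ρ g y) = B x y) ∧ ∀ x, B x x = 0 → x = 0 := by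
  have := Fintype.ofFinite G
  let b := Module.finBasis k V
  let B₀ : LinearMap.BilinForm k V := ∑ i, (LinearMap.mul k k).compl₁₂ (b.coord i) (b.coord i)
  have B₀_apply (x y) : B₀ x y = ∑ i, b.repr x i * b.repr y i := by
    simp [B₀, LinearMap.sum_apply]
  have B₀_nonneg (x) : 0 ≤ B₀ x x := by
    rw [B₀_apply]
    exact Finset.sum_nonneg fun i _ => mul_self_nonneg _
  refine ⟨∑ g, B₀.compl₁₂ (ρ g) (ρ g), fun g x y => ?_, fun x hx => ?_⟩
  · simp only [LinearMap.sum_apply, LinearMap.compl₁₂_apply]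
    refine Fintype.sum_equiv (Equiv.mulRight g) _ _ fun h => ?_
    rw [Equiv.coe_mulRight, map_mul, Module.End.mul_apply, Module.End.mul_apply]
  · simp only [LinearMap.sum_apply, LinearMap.compl₁₂_apply] at hx
    have B₀_self : B₀ (ρ 1 x) (ρ 1 x) = 0 :=
      (Finset.sum_eq_zero_iff_of_nonneg fun g _ => B₀_nonneg (ρ g x)).1 hx 1 (Finset.mem_univ _)
    rw [map_one, Module.End.one_apply, B₀_apply,
      Finset.sum_eq_zero_iff_of_nonneg fun i _ => mul_self_nonneg _] at B₀_self
    exact b.ext_elem fun i => by simpa using B₀_self i (Finset.mem_univ _)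

variable {ρ : Representation k G V} {B : LinearMap.BilinForm k V}

theorem form_symmetrizer (hB : ∀ g x y, B (ρ g x) (ρ g y) = B x y) (H : Subgroup G) [Fintype H]
    (χ : G →* ℤˣ) (x y : V) : B (symmetrizer ρ H χ x) y = B x (symmetrizer ρ H χ y) := by
  simp only [symmetrizer_apply, map_sum, LinearMap.sum_apply, Units.smul_def, map_zsmul,
    LinearMap.smul_apply]
  refine Fintype.sum_equiv (Equiv.inv _) _ _ fun h => ?_
  rw [← hB (h : G)⁻¹ (ρ h x) y, ← Module.End.mul_apply, ← map_mul]
  simp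

/-- For `P = symmetrizer ρ H χ`, `Q = symmetrizer ρ K ψ` the claim is `QPQ = 0 → PQ = 0`, as in
`‖PQx‖² = ⟨PQx, PQx⟩ = |H| ⟨Qx, PQx⟩ = |H| ⟨x, QPQx⟩`. -/
theorem symmetrizer_symmetrizer_eq_zero [LinearOrder k] [IsStrictOrderedRing k] [Finite G]
    [FiniteDimensional k V] (ρ : Representation k G V) {H K : Subgroup G} [Fintype H] [Fintype K]
    (χ ψ : G →* ℤˣ) {x : V}
    (h : symmetrizer ρ K ψ (symmetrizer ρ H χ (symmetrizer ρ K ψ x)) = 0) :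
    symmetrizer ρ H χ (symmetrizer ρ K ψ x) = 0 := by
  obtain ⟨B, hB, hB₀⟩ := exists_invariant_anisotropic_form ρ
  apply hB₀
  rw [form_symmetrizer hB, symmetrizer_symmetrizer, map_nsmul, form_symmetrizer hB, h, map_zero,
    smul_zero]

end InvariantForm

section Multiplicity

variable {k G U V : Type*} [Field k] [Group G] [AddCommGroup U] [Module k U] [AddCommGroup V]
  [Module k V] {τ : Representation k G U} {ρ : Representation k G V}

theorem map_asAlgebraHom (f : IntertwiningMap τ ρ) (a : k[G]) (v : U) :
    f (τ.asAlgebraHom a v) = ρ.asAlgebraHom a (f v) :=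
  map_smul (IntertwiningMap.equivLinearMapAsModule τ ρ f) a (τ.asModuleEquiv.symm v)

theorem exists_eq_smul_of_finrank_eq_one (hτ : finrank k (IntertwiningMap τ τ) = 1)
    (f : IntertwiningMap τ τ) : ∃ c : k, ∀ v, f v = c • v := by
  have one_ne_zero : (1 : IntertwiningMap τ τ) ≠ 0 := by
    intro h
    have := subsingleton_of_zero_eq_one h.symm
    have := finrank_zero_of_subsingleton (R := k) (M := IntertwiningMap τ τ)
    omega
  obtain ⟨c, rfl⟩ := (finrank_eq_one_iff_of_nonzero' 1 one_ne_zero).1 hτ f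
  exact ⟨c, fun v => rfl⟩

theorem exists_asAlgebraHom_eq [IsIrreducible τ] (hτ : finrank k (IntertwiningMap τ τ) = 1)
    (φ : U →ₗ[k] U) (s : Finset U) : ∃ a : k[G], ∀ v ∈ s, τ.asAlgebraHom a v = φ v := by
  let φ' : Module.End (Module.End k[G] τ.asModule) τ.asModule :=
    { toFun := φ
      map_add' := map_add φ
      map_smul' := fun e v => by
        obtain ⟨c, hc⟩ := exists_eq_smul_of_finrank_eq_one hτ
          ((IntertwiningMap.equivLinearMapAsModule τ τ).symm e)
        exact (congrArg φ (hc v)).trans ((map_smul φ c v).trans (hc (φ v)).symm) }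
  obtain ⟨a, ha⟩ := jacobson_density φ' s
  exact ⟨a, fun v hv => (ha v hv).symm⟩

/-- Jacobson density provides `a ∈ k[G]` acting on the vectors `z i` as `v ↦ φ(v) w`, where the
functional `φ` does not vanish on some `z j`; it turns the relation into `∑ φ(z i) f i = 0`. -/
theorem eq_zero_of_sum_intertwiningMap_eq_zero [IsIrreducible τ]
    (hτ : finrank k (IntertwiningMap τ τ) = 1) {ι : Type*} [Fintype ι]
    {f : ι → IntertwiningMap τ ρ} (hf : LinearIndependent k f) {z : ι → U}
    (hz : ∑ i, f i (z i) = 0) : z = 0 := by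
  classical
  funext j
  by_contra hj
  obtain ⟨φ, hφ⟩ := Module.Projective.exists_dual_eq_one k hj
  have relation : ∑ i, φ (z i) • f i = 0 := by
    ext w
    obtain ⟨a, ha⟩ := exists_asAlgebraHom_eq hτ (φ.smulRight w) (Finset.univ.image z)
    have hw (i : ι) : τ.asAlgebraHom a (z i) = φ (z i) • w :=
      ha _ (Finset.mem_image_of_mem z (Finset.mem_univ i))
    have := congrArg (ρ.asAlgebraHom a) hz
    simp only [map_sum, ← map_asAlgebraHom, hw, map_smul, map_zero] at this
    simpa [IntertwiningMap.sum_apply] using this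
  exact one_ne_zero (hφ.symm.trans (Fintype.linearIndependent_iff.1 hf _ relation j))

end Multiplicity

/-- The inclusion of a subrepresentation as a map of representations. -/
def subtypeHom {k G V : Type*} [CommRing k] [Group G] [AddCommGroup V] [Module k V]
    {ρ : Representation k G V} (W : Subrepresentation ρ) : IntertwiningMap W.toRepresentation ρ :=
  ⟨W.toSubmodule.subtype, fun _ => rfl⟩

section Copies

variable {G U V : Type*} [Group G] [AddCommGroup U] [Module ℚ U] [AddCommGroup V] [Module ℚ V]
  {τ : Representation ℚ G U} {ρ : Representation ℚ G V}

theorem IsCopies.exists_linearIndependent [Nontrivial U] {W : Subrepresentation ρ} {m : ℕ}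
    (hW : IsCopies W τ m) :
    ∃ f : Fin m → IntertwiningMap τ ρ, LinearIndependent ℚ f ∧ ∀ i, (f i).range ≤ W := by
  obtain ⟨e⟩ := hW
  let lof (i : Fin m) : IntertwiningMap τ (directSum fun _ : Fin m => τ) :=
    ⟨DirectSum.lof ℚ (Fin m) (fun _ => U) i, fun g => by ext; simp [directSum]⟩
  refine ⟨fun i => (subtypeHom W).comp (e.symm.toIntertwiningMap.comp (lof i)), ?_, ?_⟩
  · obtain ⟨x, hx⟩ := exists_ne (0 : U)
    rw [Fintype.linearIndependent_iff]
    intro c hc i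
    have e_symm_eq_zero : e.symm (∑ j, c j • lof j x) = 0 := by
      apply Subtype.ext
      have h := congrArg (fun f => f x) hc
      simp only [IntertwiningMap.sum_apply] at h
      rw [map_sum, AddSubmonoidClass.coe_finsetSum]
      simp only [map_smul]
      exact h
    have sum_eq_zero := (EmbeddingLike.map_eq_zero_iff (f := e.symm)).1 e_symm_eq_zero
    have coord := congrArg (DirectSum.component ℚ (Fin m) (fun _ => U) i) sum_eq_zero
    simp only [map_sum, map_smul, map_zero] at coord
    rw [Finset.sum_eq_single i (fun j _ hj => ?_) (by simp)] at coord
    · exact (smul_eq_zero.1 (by simpa [lof] using coord)).resolve_right hx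
    · simp [lof, DirectSum.component.of, hj]
  · rintro i _ ⟨x, rfl⟩
    exact Subtype.prop _

theorem exists_isCopies_of_linearIndependent [IsIrreducible τ]
    (hτ : finrank ℚ (IntertwiningMap τ τ) = 1) {m : ℕ} {f : Fin m → IntertwiningMap τ ρ}
    (hf : LinearIndependent ℚ f) {Y : Subrepresentation ρ} (hY : ∀ i, (f i).range ≤ Y) :
    ∃ W ≤ Y, IsCopies W τ m := by
  let F : IntertwiningMap (directSum fun _ : Fin m => τ) ρ :=
    ∑ i, (f i).comp ⟨DirectSum.component ℚ (Fin m) (fun _ => U) i, fun g =>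
      LinearMap.ext fun z => DirectSum.lmap_apply (fun _ => τ g) z i⟩
  have F_apply (z) : F z = ∑ i, f i (z i) := IntertwiningMap.sum_apply ..
  have F_injective : Function.Injective F.toLinearMap := by
    refine (injective_iff_map_eq_zero _).2 fun z hz => DFinsupp.ext fun i => ?_
    exact congrFun (eq_zero_of_sum_intertwiningMap_eq_zero hτ hf ((F_apply z).symm.trans hz)) i
  refine ⟨F.range, ?_, ⟨(Representation.Equiv.mk (LinearEquiv.ofInjective F.toLinearMap F_injective)
    fun g => ?_).symm⟩⟩
  · rintro _ ⟨z, rfl⟩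
    exact (F_apply z).symm ▸ Submodule.sum_mem Y.toSubmodule fun i _ => hY i ⟨_, rfl⟩
  · exact LinearMap.ext fun z => Subtype.ext (IntertwiningMap.isIntertwining _ _ F g z)

theorem multiplicity_eq_finrank [IsIrreducible τ] (hτ : finrank ℚ (IntertwiningMap τ τ) = 1)
    [Module.Finite ℚ (IntertwiningMap τ ρ)] :
    multiplicity τ ρ = finrank ℚ (IntertwiningMap τ ρ) := by
  have : Nontrivial U := IsSimpleModule.nontrivial ℚ[G] τ.asModule
  refine le_antisymm (sSup_le ?_) (le_sSup ⟨_, rfl, ?_⟩)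
  · rintro _ ⟨m, rfl, W, hW⟩
    obtain ⟨f, hf, -⟩ := hW.exists_linearIndependent
    simpa using hf.fintype_card_le_finrank
  · obtain ⟨W, -, hW⟩ := exists_isCopies_of_linearIndependent hτ
      (finBasis ℚ (IntertwiningMap τ ρ)).linearIndependent
      (Y := ⊤) fun _ => le_top
    exact ⟨W, hW⟩

end Copies

section Frobenius

variable {k G H U V : Type*} [Group G] [Group H] [AddCommGroup U] [AddCommGroup V]

section CommRing

variable [CommRing k] [Module k U] [Module k V] {φ : G →* H} (σ : Representation k G V)

theorem indMk_map_mul (g : G) (h : H) (v : V) :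
    IndV.mk φ σ (φ g * h) (σ g v) = IndV.mk φ σ h v := by
  simpa using Coinvariants.mk_self_apply (tprod ((leftRegular k H).comp φ) σ) g
    (TensorProduct.tmul k (MonoidAlgebra.single h 1) v)

/-- The projection of `Ind σ = ⨁_{h ∈ G\H} h⁻¹ V` onto the summand `V` of the trivial coset. -/
noncomputable def indProj (hφ : Function.Injective φ) : IndV φ σ →ₗ[k] V :=
  Coinvariants.lift _
    (TensorProduct.lift
      ((MonoidAlgebra.basis H k).constr k (Function.extend φ (fun g => σ g⁻¹) 0))) fun g => by
    refine TensorProduct.ext ((MonoidAlgebra.basis H k).ext fun h => LinearMap.ext fun v => ?_)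
    suffices Function.extend φ (fun g => σ g⁻¹) 0 (φ g * h) (σ g v) =
        Function.extend φ (fun g => σ g⁻¹) 0 h v by
      have basis_mul : leftRegular k H (φ g) (MonoidAlgebra.basis H k h) =
          MonoidAlgebra.basis H k (φ g * h) := by simp
      simpa [basis_mul, Basis.constr_basis, -MonoidAlgebra.basis_apply] using this
    by_cases hh : ∃ g', φ g' = h
    · obtain ⟨g', rfl⟩ := hh
      rw [← map_mul, hφ.extend_apply, hφ.extend_apply, ← Module.End.mul_apply, ← map_mul]
      group
    · have hgh : ¬∃ g', φ g' = φ g * h := fun ⟨g', hg'⟩ =>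
        hh ⟨g⁻¹ * g', by rw [map_mul, hg', map_inv, inv_mul_cancel_left]⟩
      rw [Function.extend_apply' _ _ _ hh, Function.extend_apply' _ _ _ hgh]
      rfl

variable (hφ : Function.Injective φ)

theorem indProj_mk (h : H) (v : V) :
    indProj σ hφ (IndV.mk φ σ h v) = Function.extend φ (fun g => σ g⁻¹) 0 h v := by
  simp [indProj, ← MonoidAlgebra.basis_apply, Basis.constr_basis]

theorem indProj_mk_map (g : G) (v : V) : indProj σ hφ (IndV.mk φ σ (φ g) v) = σ g⁻¹ v := by
  rw [indProj_mk, hφ.extend_apply]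

theorem indProj_mk_of_notMem {h : H} (hh : h ∉ φ.range) (v : V) :
    indProj σ hφ (IndV.mk φ σ h v) = 0 := by
  rw [indProj_mk, Function.extend_apply' _ _ _ hh]
  rfl

theorem indProj_ind_map (g : G) (x : IndV φ σ) :
    indProj σ hφ (ind φ σ (φ g) x) = σ g (indProj σ hφ x) := by
  suffices indProj σ hφ ∘ₗ ind φ σ (φ g) = σ g ∘ₗ indProj σ hφ from LinearMap.congr_fun this x
  refine IndV.hom_ext _ _ fun h => LinearMap.ext fun v => ?_
  change indProj σ hφ (ind φ σ (φ g) (IndV.mk φ σ h v)) = σ g (indProj σ hφ (IndV.mk φ σ h v))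
  rw [ind_mk]
  by_cases hh : h ∈ φ.range
  · obtain ⟨g', rfl⟩ := hh
    rw [← map_inv, ← map_mul, indProj_mk_map, indProj_mk_map, ← Module.End.mul_apply, ← map_mul,
      mul_inv_rev, inv_inv]
  · rw [indProj_mk_of_notMem σ hφ hh, map_zero, indProj_mk_of_notMem]
    rwa [Subgroup.mul_mem_cancel_right _ (φ.range.inv_mem ⟨g, rfl⟩)]

variable [Fintype G] [Fintype H]

theorem sum_indMk_indProj_ind (x : IndV φ σ) :
    ∑ h, IndV.mk φ σ h (indProj σ hφ (ind φ σ h x)) = Fintype.card G • x := by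
  suffices ∑ h, IndV.mk φ σ h ∘ₗ indProj σ hφ ∘ₗ ind φ σ h =
      Fintype.card G • LinearMap.id by
    simpa [LinearMap.sum_apply] using LinearMap.congr_fun this x
  refine IndV.hom_ext _ _ fun h => LinearMap.ext fun v => ?_
  rw [LinearMap.comp_apply, LinearMap.sum_apply, ← Finset.card_univ]
  change ∑ h', IndV.mk φ σ h' (indProj σ hφ (ind φ σ h' (IndV.mk φ σ h v))) =
    Finset.univ.card • IndV.mk φ σ h v
  rw [← Finset.sum_const]
  symm
  refine Fintype.sum_of_injective (fun g => φ g * h) (fun a b hab => hφ (mul_right_cancel hab))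
    _ _ (fun h' hh' => ?_) fun g => ?_
  · rw [ind_mk, indProj_mk_of_notMem, map_zero]
    rintro ⟨g, hg⟩
    refine hh' ⟨g⁻¹, ?_⟩
    change φ g⁻¹ * h = h'
    rw [map_inv, hg, mul_inv_rev, inv_inv, inv_mul_cancel_right]
  · rw [ind_mk, mul_inv_rev, mul_inv_cancel_left, ← map_inv, indProj_mk_map, inv_inv,
      indMk_map_mul]

end CommRing

section Field

variable [Field k] [Module k U] [Module k V] {φ : G →* H} {σ : Representation k G V}
  (hφ : Function.Injective φ) [Fintype G] [NeZero (Fintype.card G : k)]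

theorem eq_zero_of_indProj_ind_eq_zero [Finite H] {x : IndV φ σ}
    (hx : ∀ h, indProj σ hφ (ind φ σ h x) = 0) : x = 0 := by
  have := Fintype.ofFinite H
  have := sum_indMk_indProj_ind σ hφ x
  simp only [hx, map_zero, Finset.sum_const_zero, ← Nat.cast_smul_eq_nsmul k] at this
  exact (smul_eq_zero.1 this.symm).resolve_left (NeZero.ne _)

/-- Frobenius reciprocity `Hom_H(τ, Ind σ) ≃ Hom_G(Res τ, σ)` for finite groups `G ≤ H`: compose
with the projection `Ind σ → σ`. The inverse sends `ψ` to the average of `h ↦ h⁻¹ ψ(h x)`. -/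
noncomputable def frobenius [Fintype H] (τ : Representation k H U) (σ : Representation k G V) :
    IntertwiningMap τ (ind φ σ) ≃ₗ[k] IntertwiningMap (τ.comp φ) σ where
  toFun f := ⟨indProj σ hφ ∘ₗ f.toLinearMap, fun g => LinearMap.ext fun x =>
    (congrArg (indProj σ hφ) (f.isIntertwining _ _ (φ g) x)).trans (indProj_ind_map σ hφ g (f x))⟩
  map_add' f f' := by ext; simp
  map_smul' c f := by ext; simp
  invFun ψ := ⟨(Fintype.card G : k)⁻¹ • ∑ h, IndV.mk φ σ h ∘ₗ ψ.toLinearMap ∘ₗ τ h, fun h => by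
    ext x
    simp only [LinearMap.comp_apply, LinearMap.smul_apply, LinearMap.sum_apply, map_smul, map_sum]
    congr 1
    refine Fintype.sum_equiv (Equiv.mulRight h) _ _ fun h' => ?_
    refine Eq.trans ?_ (ind_mk φ σ h (h' * h) _).symm
    rw [mul_inv_cancel_right, Equiv.coe_mulRight, map_mul, Module.End.mul_apply]
    rfl⟩
  left_inv f := by
    ext x
    suffices (Fintype.card G : k)⁻¹ • ∑ h, IndV.mk φ σ h (indProj σ hφ (f (τ h x))) = f x by
      simpa [LinearMap.sum_apply] using this
    simp only [IntertwiningMap.isIntertwining]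
    rw [sum_indMk_indProj_ind, ← Nat.cast_smul_eq_nsmul k, inv_smul_smul₀ (NeZero.ne _)]
  right_inv ψ := by
    ext x
    suffices (Fintype.card G : k)⁻¹ • ∑ h, indProj σ hφ (IndV.mk φ σ h (ψ (τ h x))) = ψ x by
      simpa [LinearMap.sum_apply] using this
    rw [← Fintype.sum_of_injective φ hφ (fun _ : G => ψ x) _
        (fun h hh => indProj_mk_of_notMem σ hφ hh _) fun g => ?_,
      Finset.sum_const, Finset.card_univ, ← Nat.cast_smul_eq_nsmul k, inv_smul_smul₀ (NeZero.ne _)]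
    rw [indProj_mk_map]
    change _ = σ g⁻¹ (ψ ((τ.comp φ) g x))
    rw [IntertwiningMap.isIntertwining, ← Module.End.mul_apply, ← map_mul, inv_mul_cancel, map_one,
      Module.End.one_apply]

end Field

end Frobenius

section Permutations

variable {n k ℓ : ℕ}

theorem stdHom_injective (n : ℕ) : Function.Injective (stdHom n) := by
  intro σ τ h
  ext i
  have := congrArg (fun π : Equiv.Perm (Fin (n + 1)) => (π i.castSucc : ℕ)) h
  simpa [stdHom_castSucc] using this

theorem sign_stdHom (σ : Equiv.Perm (Fin n)) :
    Equiv.Perm.sign (stdHom n σ) = Equiv.Perm.sign σ := by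
  change Equiv.Perm.sign (finSumFinEquiv.permCongr (Equiv.Perm.sumCongr σ 1)) = _
  rw [Equiv.Perm.sign_permCongr, Equiv.Perm.sign_sumCongr, Equiv.Perm.sign_one, mul_one]

theorem youngHom_injective (k ℓ : ℕ) : Function.Injective (youngHom k ℓ) :=
  finSumFinEquiv.permCongrHom.injective.comp Equiv.Perm.sumCongrHom_injective

theorem mem_range_youngHom_iff {σ : Equiv.Perm (Fin (k + ℓ))} :
    σ ∈ (youngHom k ℓ).range ↔ ∀ i : Fin (k + ℓ), (i : ℕ) < k → (σ i : ℕ) < k := by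
  refine ⟨?_, fun h => ?_⟩
  · rintro ⟨g, rfl⟩ i hi
    rw [← Fin.castAdd_castLT ℓ i hi, youngHom_castAdd]
    exact (g.1 _).2
  · obtain ⟨g, hg⟩ := Equiv.Perm.mem_sumCongrHom_range_of_perm_mapsTo_inl
      (σ := finSumFinEquiv.permCongrHom.symm σ) <| by
        rintro _ ⟨i, rfl⟩
        exact ⟨⟨_, h (Fin.castAdd ℓ i) i.2⟩, finSumFinEquiv.injective (by
          simp [Equiv.permCongrHom])⟩
    refine ⟨g, ?_⟩
    rw [youngHom, MonoidHom.comp_apply, hg]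
    exact MulEquiv.apply_symm_apply _ σ

theorem exists_youngHom_one_eq {σ : Equiv.Perm (Fin (k + ℓ))}
    (h : ∀ i : Fin (k + ℓ), (i : ℕ) < k → σ i = i) :
    ∃ g : Equiv.Perm (Fin ℓ), youngHom k ℓ (1, g) = σ := by
  obtain ⟨⟨a, b⟩, rfl⟩ := mem_range_youngHom_iff.2 fun i hi => (h i hi).symm ▸ hi
  obtain rfl : a = 1 := Equiv.ext fun i => by
    simpa [youngHom_castAdd] using h (Fin.castAdd ℓ i) i.2
  exact ⟨b, rfl⟩

theorem exists_stdHom_eq {σ : Equiv.Perm (Fin (n + 1))} (h : σ (Fin.last n) = Fin.last n) :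
    ∃ τ, stdHom n τ = σ := by
  obtain ⟨⟨a, b⟩, rfl⟩ := (mem_range_youngHom_iff (k := n) (ℓ := 1) (σ := σ)).2 fun i hi =>
    Fin.val_lt_last fun hσi => hi.ne (congrArg Fin.val (σ.injective (hσi.trans h.symm)))
  exact ⟨a, by rw [Subsingleton.elim b 1]; rfl⟩

theorem stdHom_mem_range_youngHom_iff {σ : Equiv.Perm (Fin (k + ℓ))} :
    stdHom (k + ℓ) σ ∈ (youngHom k (ℓ + 1)).range ↔ σ ∈ (youngHom k ℓ).range := by
  refine ⟨fun h => mem_range_youngHom_iff.2 fun i hi => ?_, ?_⟩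
  · simpa [stdHom_castSucc] using mem_range_youngHom_iff.1 h i.castSucc hi
  · rintro ⟨g, rfl⟩
    exact ⟨_, youngHom_stdHom g⟩

end Permutations

/-- The sum `∑_{i ∈ s} (i n+1) f(x)` over a set `s` of letters, for a map `f` to a representation
of `S_{n+1}`; the letter `n+1` is `Fin.last n`. -/
noncomputable def swapSum {n : ℕ} {X X' : Type*} [AddCommGroup X] [Module ℚ X] [AddCommGroup X']
    [Module ℚ X'] (ρ' : Representation ℚ (Equiv.Perm (Fin (n + 1))) X') (f : X →ₗ[ℚ] X')
    (s : Finset (Fin (n + 1))) : X →ₗ[ℚ] X' :=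
  ∑ i ∈ s, ρ' (Equiv.swap i (Fin.last n)) ∘ₗ f

section InducedSequence

variable {k : ℕ} {V : Type*} [AddCommGroup V] [Module ℚ V]
  (ρ : Representation ℚ (Equiv.Perm (Fin k)) V) (ℓ : ℕ)

/-- The projection of `I_{k+ℓ}(V)` onto `V`, the component of the trivial coset. -/
noncomputable abbrev youngProj : IndSpace ρ ℓ →ₗ[ℚ] V :=
  indProj (boxTrivial ρ ℓ) (youngHom_injective k ℓ)

theorem youngProj_indInclusion (x : IndSpace ρ ℓ) :
    youngProj ρ (ℓ + 1) (indInclusion ρ ℓ x) = youngProj ρ ℓ x := by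
  suffices youngProj ρ (ℓ + 1) ∘ₗ indInclusion ρ ℓ = youngProj ρ ℓ from LinearMap.congr_fun this x
  refine IndV.hom_ext _ _ fun σ => LinearMap.ext fun v => ?_
  refine (congrArg (youngProj ρ (ℓ + 1)) (indInclusion_mk ρ ℓ σ v)).trans ?_
  by_cases hσ : σ ∈ (youngHom k ℓ).range
  · obtain ⟨g, rfl⟩ := hσ
    rw [← youngHom_stdHom]
    exact (indProj_mk_map _ (youngHom_injective k (ℓ + 1)) _ v).trans
      (indProj_mk_map (boxTrivial ρ ℓ) (youngHom_injective k ℓ) g v).symm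
  · exact (indProj_mk_of_notMem _ _ (mt stdHom_mem_range_youngHom_iff.1 hσ) v).trans
      (indProj_mk_of_notMem (boxTrivial ρ ℓ) (youngHom_injective k ℓ) hσ v).symm

theorem indInclusion_injective : Function.Injective (indInclusion ρ ℓ) := by
  refine (injective_iff_map_eq_zero _).2 fun x hx =>
    eq_zero_of_indProj_ind_eq_zero (youngHom_injective k ℓ) fun σ => ?_
  rw [← youngProj_indInclusion, indInclusion_equivariant, hx, map_zero, map_zero]

theorem groupSpan_range_indInclusion :
    (groupSpan (indRep ρ (ℓ + 1)) (Set.range (indInclusion ρ ℓ))).toSubmodule = ⊤ := by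
  rw [← Submodule.ker_mkQ (groupSpan _ _).toSubmodule, LinearMap.ker_eq_top]
  refine IndV.hom_ext _ _ fun σ => LinearMap.ext fun v => ?_
  refine (Submodule.Quotient.mk_eq_zero _).2 (Submodule.subset_span
    ⟨σ⁻¹, _, ⟨IndV.mk (youngHom k ℓ) (boxTrivial ρ ℓ) 1 v, rfl⟩, ?_⟩)
  rw [indInclusion_mk, map_one]
  refine Eq.trans ?_ (ind_mk (youngHom k (ℓ + 1)) (boxTrivial ρ (ℓ + 1)) σ⁻¹ 1 v).symm
  rw [one_mul, inv_inv]

theorem youngProj_swap_indInclusion (j : Fin (k + ℓ + 1)) (x : IndSpace ρ ℓ) :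
    youngProj ρ (ℓ + 1) (indRep ρ (ℓ + 1) (Equiv.swap j (Fin.last (k + ℓ)))
      (indInclusion ρ ℓ x)) = if k ≤ (j : ℕ) then youngProj ρ ℓ x else 0 := by
  split_ifs with hj
  · obtain ⟨g, hg⟩ := exists_youngHom_one_eq (k := k) (ℓ := ℓ + 1)
      (σ := Equiv.swap j (Fin.last (k + ℓ))) fun i hi =>
        Equiv.swap_apply_of_ne_of_ne (by rintro rfl; omega)
          (Fin.ne_of_lt (by exact Nat.lt_of_lt_of_le hi (Nat.le_add_right k ℓ)))
    rw [← hg, indProj_ind_map, youngProj_indInclusion, MonoidHom.comp_apply, MonoidHom.coe_fst,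
      map_one, Module.End.one_apply]
  · suffices youngProj ρ (ℓ + 1) ∘ₗ indRep ρ (ℓ + 1) (Equiv.swap j (Fin.last (k + ℓ))) ∘ₗ
        indInclusion ρ ℓ = 0 from LinearMap.congr_fun this x
    refine IndV.hom_ext _ _ fun σ => LinearMap.ext fun v => ?_
    refine (congrArg (fun y => youngProj ρ (ℓ + 1) (indRep ρ (ℓ + 1)
      (Equiv.swap j (Fin.last (k + ℓ))) y)) (indInclusion_mk ρ ℓ σ v)).trans ?_
    refine (congrArg (youngProj ρ (ℓ + 1))
      (ind_mk (youngHom k (ℓ + 1)) (boxTrivial ρ (ℓ + 1)) _ _ v)).trans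
      (indProj_mk_of_notMem _ _ (fun hσ => ?_) v)
    have hlt := mem_range_youngHom_iff.1 hσ j (not_le.1 hj)
    rw [Equiv.swap_inv, Equiv.Perm.mul_apply, Equiv.swap_apply_left, stdHom_last] at hlt
    simp at hlt

/-- The inclusion `ι_n` as a map of representations of `S_n`. -/
noncomputable def indInclusionHom :
    IntertwiningMap (indRep ρ ℓ) ((indRep ρ (ℓ + 1)).comp (stdHom (k + ℓ))) :=
  ⟨indInclusion ρ ℓ, fun σ => LinearMap.ext (indInclusion_equivariant ρ ℓ σ)⟩

theorem youngProj_stdHom_swapSum (s : Finset (Fin (k + ℓ + 1))) (σ : Equiv.Perm (Fin (k + ℓ)))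
    (x : IndSpace ρ ℓ) :
    youngProj ρ (ℓ + 1) (indRep ρ (ℓ + 1) (stdHom (k + ℓ) σ)
      (swapSum (n := k + ℓ) (indRep ρ (ℓ + 1)) (indInclusion ρ ℓ) s x)) =
      (s.filter fun i => k ≤ (stdHom (k + ℓ) σ i : ℕ)).card • youngProj ρ ℓ (indRep ρ ℓ σ x) := by
  rw [swapSum, LinearMap.sum_apply, map_sum, map_sum, ← Finset.sum_const, Finset.sum_filter]
  refine Finset.sum_congr rfl fun i _ => ?_
  rw [← youngProj_swap_indInclusion, indInclusion_equivariant]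
  congr 1
  have conj_swap : stdHom (k + ℓ) σ * Equiv.swap i (Fin.last (k + ℓ)) =
      Equiv.swap (stdHom (k + ℓ) σ i) (Fin.last (k + ℓ)) * stdHom (k + ℓ) σ := by
    rw [Equiv.mul_swap_eq_swap_mul, stdHom_last]
  have := congrArg (fun π => indRep ρ (ℓ + 1) π (indInclusion ρ ℓ x)) conj_swap
  exact (LinearMap.congr_fun (map_mul (indRep ρ (ℓ + 1)) _ _) _).symm.trans
    (this.trans (LinearMap.congr_fun (map_mul (indRep ρ (ℓ + 1)) _ _) _))

theorem swapSum_indInclusion_injective {s : Finset (Fin (k + ℓ + 1))}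
    (hs : Fin.last (k + ℓ) ∈ s) :
    Function.Injective (swapSum (n := k + ℓ) (indRep ρ (ℓ + 1)) (indInclusion ρ ℓ) s) := by
  refine (injective_iff_map_eq_zero _).2 fun x hx =>
    eq_zero_of_indProj_ind_eq_zero (youngHom_injective k ℓ) fun σ => ?_
  have := youngProj_stdHom_swapSum ρ ℓ s σ x
  rw [hx, map_zero, map_zero, eq_comm, ← Nat.cast_smul_eq_nsmul ℚ, smul_eq_zero, Nat.cast_eq_zero,
    Finset.card_eq_zero] at this
  refine this.resolve_left (Finset.Nonempty.ne_empty ⟨Fin.last (k + ℓ), ?_⟩)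
  rw [Finset.mem_filter, stdHom_last]
  exact ⟨hs, Nat.le_add_right k ℓ⟩

end InducedSequence

section Tableaux

variable {μ : YoungDiagram} {n : ℕ}

theorem Tabloid.mk_eq_mk {T S : Tableau μ n} :
    Tabloid.mk T = Tabloid.mk S ↔ ∀ x, T.rowOf x = S.rowOf x :=
  Quotient.eq (r := Tableau.rowSetoid μ n)

instance : Finite (Tabloid μ n) := inferInstanceAs (Finite (Quotient (Tableau.rowSetoid μ n)))

instance : Module.Finite ℚ ℚ[Tabloid μ n] :=
  Module.Finite.equiv (MonoidAlgebra.coeffLinearEquiv ℚ).symm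

namespace Tableau

variable (T S : Tableau μ n)

theorem exists_smul_eq : ∃ σ : Equiv.Perm (Fin n), σ • T = S :=
  ⟨T.symm.trans S, by ext c; simp [smul_apply]⟩

/-- The row stabilizer of `T`: the permutations that fix the tabloid of `T`. -/
abbrev rowStab : Subgroup (Equiv.Perm (Fin n)) :=
  MulAction.stabilizer (Equiv.Perm (Fin n)) (Tabloid.mk T)

variable {T} in
theorem mem_rowStab {σ : Equiv.Perm (Fin n)} :
    σ ∈ T.rowStab ↔ ∀ x, T.rowOf (σ x) = T.rowOf x := by
  rw [MulAction.mem_stabilizer_iff, Tabloid.smul_mk, eq_comm, Tabloid.mk_eq_mk,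
    ← σ.forall_congr_right]
  simp only [rowOf_smul, ← Equiv.Perm.mul_apply, inv_mul_cancel, Equiv.Perm.one_apply]

instance : DecidablePred (· ∈ T.rowStab) := fun _ => decidable_of_iff _ mem_rowStab.symm

variable {T} in
theorem eq_one_of_mem_colStab_of_mem_rowStab {q : Equiv.Perm (Fin n)} (hc : q ∈ T.colStab)
    (hr : q ∈ T.rowStab) : q = 1 :=
  Equiv.ext fun x => T.symm.injective (Subtype.ext (Prod.ext (mem_rowStab.1 hr x) (hc x)))

variable {T} in
theorem swap_mem_colStab {x y : Fin n} (h : T.colOf x = T.colOf y) :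
    Equiv.swap x y ∈ T.colStab := fun z => by
  rw [Equiv.swap_apply_def]
  split_ifs with hx hy
  · rw [hx, h]
  · rw [hy, h]
  · rfl

variable {T} in
theorem swap_mem_rowStab {x y : Fin n} (h : T.rowOf x = T.rowOf y) :
    Equiv.swap x y ∈ T.rowStab := mem_rowStab.2 fun z => by
  rw [Equiv.swap_apply_def]
  split_ifs with hx hy
  · rw [hx, h]
  · rw [hy, h]
  · rfl

/-- The labels of the column of `x` in `T` that lie in a higher row of `S` than `x`; sorting the
columns of `T` by the rows of `S` puts `x` below exactly these labels. -/
def above (x : Fin n) : Finset (Fin n) := {y | T.colOf y = T.colOf x ∧ S.rowOf y < S.rowOf x}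

theorem card_above_mem (x : Fin n) : ((T.above S x).card, T.colOf x) ∈ μ.cells := by
  rw [YoungDiagram.mem_cells, YoungDiagram.mem_iff_lt_colLen, YoungDiagram.colLen_eq_card]
  calc (T.above S x).card < ({y | T.colOf y = T.colOf x} : Finset (Fin n)).card := by
        refine Finset.card_lt_card (Finset.ssubset_iff_of_subset ?_ |>.2 ⟨x, ?_, ?_⟩)
        · intro y; simp +contextual [above]
        · simp
        · simp [above]
    _ ≤ (μ.col (T.colOf x)).card := by
        refine Finset.card_le_card_of_injOn (fun y => (T.symm y).1) (fun y hy => ?_)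
          fun y _ z _ hyz => T.symm.injective (Subtype.ext hyz)
        rw [Finset.mem_coe, Finset.mem_filter] at hy
        exact YoungDiagram.mem_col_iff.2 ⟨(T.symm y).2, hy.2⟩

theorem card_above_lt {x y : Fin n} (hc : T.colOf x = T.colOf y) (hr : S.rowOf x < S.rowOf y) :
    (T.above S x).card < (T.above S y).card := by
  refine Finset.card_lt_card (Finset.ssubset_iff_of_subset ?_ |>.2 ⟨x, ?_, ?_⟩)
  · intro z
    simp only [above, Finset.mem_filter_univ]
    exact fun hz => ⟨hz.1.trans hc, hz.2.trans hr⟩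
  · simp [above, hc, hr]
  · simp [above]

variable {T S} (h : ∀ x y, T.colOf x = T.colOf y → S.rowOf x = S.rowOf y → x = y)
include h

theorem card_above_le (x : Fin n) : (T.above S x).card ≤ S.rowOf x := by
  rw [← Finset.card_range (S.rowOf x)]
  refine Finset.card_le_card_of_injOn S.rowOf (fun y hy => ?_) fun y hy z hz hyz => ?_
  · simpa using (Finset.mem_filter_univ y).1 hy |>.2
  · have hy := (Finset.mem_filter_univ y).1 hy
    have hz := (Finset.mem_filter_univ z).1 hz
    exact h y z (hy.1.trans hz.1.symm) hyz

theorem card_above_injective :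
    Function.Injective fun x => ((T.above S x).card, T.colOf x) := by
  intro x y hxy
  obtain ⟨hcard, hcol⟩ := Prod.ext_iff.1 hxy
  refine h x y hcol (le_antisymm ?_ ?_)
  · exact not_lt.1 fun hlt => (card_above_lt T S hcol.symm hlt).ne' hcard
  · exact not_lt.1 fun hlt => (card_above_lt T S hcol hlt).ne hcard

/-- The tableau `T₁` that sorts the columns of `T` by the rows of `S` has `T₁.rowOf ≤ S.rowOf`;
both sides have the same sum, so they agree. -/
theorem exists_mem_colStab_smul_mk_eq : ∃ q ∈ T.colStab, q • Tabloid.mk T = Tabloid.mk S := by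
  let box (x : Fin n) : μ.cells := ⟨_, card_above_mem T S x⟩
  have box_injective : Function.Injective box := fun x y hxy =>
    card_above_injective h (congrArg Subtype.val hxy)
  have box_bijective : Function.Bijective box :=
    (Fintype.bijective_iff_injective_and_card box).2 ⟨box_injective, Fintype.card_congr T.symm⟩
  obtain ⟨q, hq⟩ := T.exists_smul_eq (Equiv.ofBijective box box_bijective).symm
  have rowOf_le (x) : (q • T).rowOf x ≤ S.rowOf x := by
    rw [hq]
    exact card_above_le h x
  have sum_rowOf : ∑ x, (q • T).rowOf x = ∑ x, S.rowOf x :=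
    (Equiv.sum_comp (q • T).symm fun c => c.1.1).trans (Equiv.sum_comp S.symm fun c => c.1.1).symm
  have rowOf_eq := (Finset.sum_eq_sum_iff_of_le fun x _ => rowOf_le x).1 sum_rowOf
  refine ⟨q, fun x => ?_, ?_⟩
  · have colOf_eq : (q • T).colOf (q x) = T.colOf (q x) := congrFun (congrArg colOf hq) (q x)
    rw [← colOf_eq, colOf_smul, ← Equiv.Perm.mul_apply, inv_mul_cancel, Equiv.Perm.one_apply]
  · rw [Tabloid.smul_mk, Tabloid.mk_eq_mk]
    exact fun x => rowOf_eq x (Finset.mem_univ x)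

end Tableau

end Tableaux

section Specht

variable {μ : YoungDiagram} {n : ℕ} (T : Tableau μ n) {X : Type*} [AddCommGroup X] [Module ℚ X]
  (ρ : Representation ℚ (Equiv.Perm (Fin n)) X)

/-- The signed column symmetrizer of `T`. -/
abbrev colSym : X →ₗ[ℚ] X := symmetrizer ρ T.colStab Equiv.Perm.sign

/-- The row symmetrizer of `T`. -/
abbrev rowSym : X →ₗ[ℚ] X := symmetrizer ρ T.rowStab 1

theorem polytabloid_eq_colSym :
    polytabloid T = colSym T (tabloidRep μ n) (MonoidAlgebra.single (Tabloid.mk T) 1) := by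
  rw [symmetrizer_apply, polytabloid]
  refine Finset.sum_congr rfl fun q _ => ?_
  rw [ofMulAction_single, Tabloid.smul_mk, Units.smul_def, ← Int.cast_smul_eq_zsmul ℚ,
    MonoidAlgebra.smul_single, smul_eq_mul, mul_one]

theorem colSym_polytabloid :
    colSym T (tabloidRep μ n) (polytabloid T) = Fintype.card T.colStab • polytabloid T := by
  rw [polytabloid_eq_colSym, symmetrizer_symmetrizer]

theorem coeff_polytabloid_self : (polytabloid T).coeff (Tabloid.mk T) = 1 := by
  classical
  rw [polytabloid, MonoidAlgebra.coeff_sum, Finsupp.finsetSum_apply, Finset.sum_eq_single 1]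
  · simp
  · intro q _ hq
    rw [MonoidAlgebra.coeff_single, Finsupp.single_apply, if_neg]
    exact fun h => hq (Subtype.ext (Tableau.eq_one_of_mem_colStab_of_mem_rowStab q.2 h))
  · simp

theorem rowSym_polytabloid_ne_zero : rowSym T (tabloidRep μ n) (polytabloid T) ≠ 0 := by
  intro h
  have coeff_apply (σ : T.rowStab) :
      (tabloidRep μ n σ (polytabloid T)).coeff (Tabloid.mk T) = 1 := by
    rw [coeff_ofMulAction, inv_smul_eq_iff.2 σ.2.symm, coeff_polytabloid_self]
  have := congrArg (fun v : ℚ[Tabloid μ n] => v.coeff (Tabloid.mk T)) h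
  simp [symmetrizer_apply, MonoidAlgebra.coeff_sum, coeff_apply] at this

theorem colSym_single_mem_span (S : Tableau μ n) :
    colSym T (tabloidRep μ n) (MonoidAlgebra.single (Tabloid.mk S) 1) ∈
      Submodule.span ℚ {polytabloid T} := by
  by_cases h : ∀ x y, T.colOf x = T.colOf y → S.rowOf x = S.rowOf y → x = y
  · obtain ⟨q, hq, hS⟩ := Tableau.exists_mem_colStab_smul_mk_eq h
    rw [← hS, ← ofMulAction_single, symmetrizer_apply_of_mem _ _ hq, ← polytabloid_eq_colSym]
    exact zsmul_mem (Submodule.mem_span_singleton_self _) _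
  · push Not at h
    obtain ⟨x, y, hc, hr, hxy⟩ := h
    have eq_neg := symmetrizer_apply_of_mem (tabloidRep μ n) Equiv.Perm.sign
      (Tableau.swap_mem_colStab hc) (MonoidAlgebra.single (Tabloid.mk S) 1)
    rw [ofMulAction_single, MulAction.mem_stabilizer_iff.1 (Tableau.swap_mem_rowStab hr),
      Equiv.Perm.sign_swap hxy, Units.neg_smul, one_smul] at eq_neg
    have := IsAddTorsionFree.of_module_rat (M := ℚ[Tabloid μ n])
    rw [self_eq_neg.1 eq_neg]
    exact Submodule.zero_mem _

theorem colSym_mem_span (v : ℚ[Tabloid μ n]) :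
    colSym T (tabloidRep μ n) v ∈ Submodule.span ℚ {polytabloid T} := by
  suffices (Submodule.span ℚ {polytabloid T}).mkQ ∘ₗ colSym T (tabloidRep μ n) = 0 from
    (Submodule.Quotient.mk_eq_zero _).1 (LinearMap.congr_fun this v)
  refine (MonoidAlgebra.basis (Tabloid μ n) ℚ).ext fun t => ?_
  induction t using Quotient.inductionOn with | h S => ?_
  exact (Submodule.Quotient.mk_eq_zero _).2 (colSym_single_mem_span T S)

/-- The Specht module as a representation. -/
noncomputable abbrev spechtRep (μ : YoungDiagram) (n : ℕ) :
    Representation ℚ (Equiv.Perm (Fin n)) (specht μ n).toSubmodule :=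
  (specht μ n).toRepresentation

/-- The polytabloid `v_T` as an element of the Specht module. -/
noncomputable def spechtVec : (specht μ n).toSubmodule :=
  ⟨polytabloid T, Submodule.subset_span ⟨T, rfl⟩⟩

theorem spechtRep_spechtVec (σ : Equiv.Perm (Fin n)) :
    spechtRep μ n σ (spechtVec T) = spechtVec (σ • T) :=
  Subtype.ext (tabloidRep_polytabloid σ T)

theorem span_range_spechtVec :
    Submodule.span ℚ (Set.range (spechtVec (μ := μ) (n := n))) = ⊤ := by
  refine Eq.trans (congrArg _ (Set.ext fun v => ?_)) (Submodule.span_span_coe_preimage (R := ℚ)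
    (s := Set.range (polytabloid (μ := μ) (n := n))))
  exact exists_congr fun T => Subtype.ext_iff

variable {T} in
theorem eq_top_of_spechtVec_mem {W : Subrepresentation (spechtRep μ n)}
    (h : spechtVec T ∈ W) : W = ⊤ := by
  refine Subrepresentation.toSubmodule_injective (top_unique ?_)
  rw [← span_range_spechtVec, Submodule.span_le]
  rintro _ ⟨S, rfl⟩
  obtain ⟨σ, rfl⟩ := T.exists_smul_eq S
  rw [← spechtRep_spechtVec]
  exact W.apply_mem_toSubmodule σ h

variable {ρ T} in
theorem specht_hom_ext {f g : IntertwiningMap (spechtRep μ n) ρ}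
    (h : f (spechtVec T) = g (spechtVec T)) : f = g := by
  have ker_eq_top : (f - g).ker = ⊤ :=
    eq_top_of_spechtVec_mem (T := T) (by simp [IntertwiningMap.mem_ker, h])
  ext v
  have : v ∈ (f - g).ker := ker_eq_top ▸ Submodule.mem_top
  simpa [IntertwiningMap.mem_ker, sub_eq_zero] using this

theorem colSym_spechtVec :
    colSym T (spechtRep μ n) (spechtVec T) = Fintype.card T.colStab • spechtVec T :=
  Subtype.ext ((map_symmetrizer _ _ (subtypeHom (specht μ n)) _).trans (colSym_polytabloid T))

theorem rowSym_spechtVec_ne_zero : rowSym T (spechtRep μ n) (spechtVec T) ≠ 0 := fun h =>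
  rowSym_polytabloid_ne_zero T <| (map_symmetrizer _ _ (subtypeHom (specht μ n)) _).symm.trans
    ((congrArg _ h).trans (map_zero _))

theorem exists_colSym_specht_eq (v : (specht μ n).toSubmodule) :
    ∃ c : ℚ, colSym T (spechtRep μ n) v = c • spechtVec T := by
  obtain ⟨c, hc⟩ := Submodule.mem_span_singleton.1 (colSym_mem_span T v.1)
  exact ⟨c, Subtype.ext ((map_symmetrizer _ _ (subtypeHom (specht μ n)) v).trans hc.symm)⟩

/-- A vector killed by all column symmetrizers is orthogonal to all polytabloids. -/
theorem exists_colSym_ne_zero {v : (specht μ n).toSubmodule} (hv : v ≠ 0) :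
    ∃ T : Tableau μ n, colSym T (spechtRep μ n) v ≠ 0 := by
  by_contra! h
  obtain ⟨B, hB, anisotropic⟩ := exists_invariant_anisotropic_form (tabloidRep μ n)
  have orthogonal (T) : B v.1 (polytabloid T) = 0 := by
    have colSym_v : colSym T (tabloidRep μ n) v.1 = 0 :=
      (map_symmetrizer _ _ (subtypeHom (specht μ n)) v).symm.trans (congrArg Subtype.val (h T))
    rw [polytabloid_eq_colSym, ← form_symmetrizer hB, colSym_v, map_zero, LinearMap.zero_apply]
  have specht_le : (specht μ n).toSubmodule ≤ LinearMap.ker (B v.1) :=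
    Submodule.span_le.2 (Set.range_subset_iff.2 orthogonal)
  exact hv (Subtype.ext (anisotropic _ (specht_le v.2)))

theorem spechtVec_ne_zero : spechtVec T ≠ 0 := fun h =>
  rowSym_spechtVec_ne_zero T (by rw [h, map_zero])

variable {T} in
include T in
theorem isIrreducible_spechtRep : IsIrreducible (spechtRep μ n) := by
  have : Nontrivial (Subrepresentation (spechtRep μ n)) :=
    ⟨⊥, ⊤, fun h => spechtVec_ne_zero T ((Submodule.mem_bot ℚ).1
      ((congrArg Subrepresentation.toSubmodule h).ge Submodule.mem_top))⟩
  refine { eq_bot_or_eq_top := fun W => or_iff_not_imp_left.2 fun hW => ?_ }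
  obtain ⟨v, hvW, hv⟩ := Submodule.exists_mem_ne_zero_of_ne_bot
    (mt (fun h => Subrepresentation.toSubmodule_injective h) hW)
  obtain ⟨S, hS⟩ := exists_colSym_ne_zero hv
  obtain ⟨c, hc⟩ := exists_colSym_specht_eq S v
  rw [hc] at hS
  refine eq_top_of_spechtVec_mem (T := S)
    ((W.toSubmodule.smul_mem_iff (left_ne_zero_of_smul hS)).1 ?_)
  rw [← hc]
  exact symmetrizer_mem _ _ _ W hvW

variable {T} in
include T in
theorem finrank_intertwiningMap_spechtRep :
    finrank ℚ (IntertwiningMap (spechtRep μ n) (spechtRep μ n)) = 1 := by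
  refine finrank_eq_one (1 : IntertwiningMap (spechtRep μ n) (spechtRep μ n))
    (fun h => spechtVec_ne_zero T ?_) fun f => ?_
  · exact congrArg (fun f : IntertwiningMap (spechtRep μ n) (spechtRep μ n) => f (spechtVec T)) h
  · obtain ⟨c, hc⟩ := exists_colSym_specht_eq T (f (spechtVec T))
    refine ⟨(Fintype.card T.colStab : ℚ)⁻¹ * c, specht_hom_ext (T := T) ?_⟩
    rw [← map_symmetrizer, colSym_spechtVec, map_nsmul, ← Nat.cast_smul_eq_nsmul ℚ] at hc
    rw [IntertwiningMap.smul_apply, mul_smul]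
    exact (inv_smul_eq_iff₀ (Nat.cast_ne_zero.2 Fintype.card_ne_zero)).2 hc.symm

end Specht

section OrbitSum

variable {k G X V : Type*} [CommRing k] [Group G] [Fintype G] [MulAction G X] [DecidableEq X]
  [AddCommGroup V] [Module k V] (ρ : Representation k G V) (x₀ : X)

/-- The maps of representations `k[X] → V` that send the base point `x₀` to the sum of a vector
`y` over the stabilizer of `x₀`, as a linear map in `y`. -/
noncomputable def orbitSumHom : V →ₗ[k] IntertwiningMap (ofMulAction k G X) ρ where
  toFun y := ⟨(MonoidAlgebra.basis X k).constr k fun x => ∑ g : G with g • x₀ = x, ρ g y,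
    fun g => (MonoidAlgebra.basis X k).ext fun x => by
      rw [LinearMap.comp_apply, LinearMap.comp_apply, Basis.constr_basis, MonoidAlgebra.basis_apply,
        ofMulAction_single, ← MonoidAlgebra.basis_apply, Basis.constr_basis, map_sum]
      refine (Finset.sum_equiv (Equiv.mulLeft g) (fun h => ?_) fun h _ => ?_).symm
      · simp [mul_smul]
      · rw [Equiv.coe_mulLeft, map_mul, Module.End.mul_apply]⟩
  map_add' y z := IntertwiningMap.ext <| (MonoidAlgebra.basis X k).ext fun x => by
    rw [IntertwiningMap.add_toLinearMap, LinearMap.add_apply]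
    simp only [Basis.constr_basis, map_add, Finset.sum_add_distrib]
  map_smul' c y := IntertwiningMap.ext <| (MonoidAlgebra.basis X k).ext fun x => by
    rw [IntertwiningMap.toLinearMap_smul, LinearMap.smul_apply]
    simp only [Basis.constr_basis, map_smul, Finset.smul_sum, RingHom.id_apply]

theorem orbitSumHom_single (y : V) (x : X) :
    orbitSumHom ρ x₀ y (MonoidAlgebra.single x 1) = ∑ g : G with g • x₀ = x, ρ g y :=
  Basis.constr_basis (MonoidAlgebra.basis X k) k _ x

theorem orbitSumHom_single_self [Fintype (MulAction.stabilizer G x₀)] (y : V) :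
    orbitSumHom ρ x₀ y (MonoidAlgebra.single x₀ 1) =
      symmetrizer ρ (MulAction.stabilizer G x₀) 1 y := by
  rw [orbitSumHom_single, symmetrizer_apply]
  refine (Finset.sum_subtype _ (fun g => ?_) _).trans (Finset.sum_congr rfl fun g _ => ?_)
  · simp
  · rw [MonoidHom.one_apply, one_smul]

theorem orbitSumHom_range_le {Y : Subrepresentation ρ} {y : V} (hy : y ∈ Y) :
    (orbitSumHom ρ x₀ y).range ≤ Y := by
  rintro _ ⟨v, rfl⟩
  refine (congrArg (· ∈ Y.toSubmodule) (Basis.constr_apply _ k _ v)).mpr ?_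
  exact Submodule.sum_mem _ fun x _ => Submodule.smul_mem _ _ <|
    Submodule.sum_mem _ fun g _ => Y.apply_mem_toSubmodule g hy

end OrbitSum

section SpechtLift

variable {μ : YoungDiagram} {n : ℕ} (T : Tableau μ n) {X : Type*} [AddCommGroup X] [Module ℚ X]
  (ρ : Representation ℚ (Equiv.Perm (Fin n)) X)

open Classical in
/-- The maps of representations from the Specht module to `X` that send the polytabloid of `T` to
`C R y`, where `R` and `C` are the row and column symmetrizers of `T`, as a linear map in `y`. -/
noncomputable def spechtLift : X →ₗ[ℚ] IntertwiningMap (spechtRep μ n) ρ where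
  toFun y := (orbitSumHom ρ (Tabloid.mk T) y).comp (subtypeHom (specht μ n))
  map_add' y z := by rw [map_add, IntertwiningMap.comp_add]
  map_smul' c y := by ext; simp

theorem spechtLift_spechtVec (y : X) :
    spechtLift T ρ y (spechtVec T) = colSym T ρ (rowSym T ρ y) := by
  classical
  change orbitSumHom ρ (Tabloid.mk T) y (polytabloid T) = _
  rw [polytabloid_eq_colSym, map_symmetrizer, orbitSumHom_single_self]

theorem spechtLift_range_le {Y : Subrepresentation ρ} {y : X} (hy : y ∈ Y) :
    (spechtLift T ρ y).range ≤ Y := by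
  classical
  rintro _ ⟨v, rfl⟩
  exact orbitSumHom_range_le ρ (Tabloid.mk T) hy ⟨v.1, rfl⟩

end SpechtLift

/-- The diagram `μ'` arises from `μ` by adding the box `c₀`, which is alone in its column. -/
structure AddsColumn (μ μ' : YoungDiagram) (c₀ : ℕ × ℕ) : Prop where
  cells_eq : μ'.cells = insert c₀ μ.cells
  col_ne : ∀ c ∈ μ.cells, c.2 ≠ c₀.2

namespace AddsColumn

variable {μ μ' : YoungDiagram} {c₀ : ℕ × ℕ} (h : AddsColumn μ μ' c₀) {n : ℕ} (T : Tableau μ n)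

section Tableaux

include h in
theorem newBox_mem : c₀ ∈ μ'.cells := h.cells_eq ▸ Finset.mem_insert_self _ _

include h in
theorem eq_of_col_eq {c : ℕ × ℕ} (hc : c ∈ μ'.cells) (hcol : c.2 = c₀.2) : c = c₀ :=
  (Finset.mem_insert.1 (h.cells_eq ▸ hc)).resolve_right fun hc => h.col_ne c hc hcol

/-- The box of the label `x` in the tableau `extend`. -/
def extendBox : Fin (n + 1) → μ'.cells :=
  Fin.lastCases ⟨c₀, h.newBox_mem⟩
    fun x => ⟨(T.symm x).1, h.cells_eq ▸ Finset.mem_insert_of_mem (T.symm x).2⟩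

theorem extendBox_last : (h.extendBox T (Fin.last n)).1 = c₀ := by
  simp only [extendBox, Fin.lastCases_last]

theorem extendBox_castSucc (x : Fin n) : (h.extendBox T x.castSucc).1 = (T.symm x).1 := by
  simp only [extendBox, Fin.lastCases_castSucc]

theorem extendBox_bijective : Function.Bijective (h.extendBox T) := by
  refine (Fintype.bijective_iff_injective_and_card _).2 ⟨fun x y hxy => ?_, ?_⟩
  · have box_eq := congrArg Subtype.val hxy
    induction x using Fin.lastCases with
    | last =>
      induction y using Fin.lastCases with
      | last => rfl
      | cast y =>
        rw [extendBox_last, extendBox_castSucc] at box_eq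
        exact absurd (congrArg Prod.snd box_eq.symm) (h.col_ne _ (T.symm y).2)
    | cast x =>
      induction y using Fin.lastCases with
      | last =>
        rw [extendBox_last, extendBox_castSucc] at box_eq
        exact absurd (congrArg Prod.snd box_eq) (h.col_ne _ (T.symm x).2)
      | cast y =>
        rw [extendBox_castSucc, extendBox_castSucc] at box_eq
        rw [T.symm.injective (Subtype.ext box_eq)]
  · rw [Fintype.card_coe, h.cells_eq, Finset.card_insert_of_notMem fun h' => h.col_ne _ h' rfl,
      Fintype.card_fin, ← Fintype.card_coe, Fintype.card_congr T, Fintype.card_fin]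

/-- The tableau obtained from `T` by putting the new label `Fin.last n` into the new box. -/
noncomputable def extend : Tableau μ' (n + 1) :=
  (Equiv.ofBijective _ (h.extendBox_bijective T)).symm

theorem extend_symm_last : ((h.extend T).symm (Fin.last n)).1 = c₀ := h.extendBox_last T

theorem rowOf_extend_castSucc (x : Fin n) : (h.extend T).rowOf x.castSucc = T.rowOf x :=
  congrArg Prod.fst (h.extendBox_castSucc T x)

theorem colOf_extend_castSucc (x : Fin n) : (h.extend T).colOf x.castSucc = T.colOf x :=
  congrArg Prod.snd (h.extendBox_castSucc T x)

theorem rowOf_extend_last : (h.extend T).rowOf (Fin.last n) = c₀.1 :=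
  congrArg Prod.fst (h.extend_symm_last T)

theorem colOf_extend_last : (h.extend T).colOf (Fin.last n) = c₀.2 :=
  congrArg Prod.snd (h.extend_symm_last T)

theorem extend_smul (σ : Equiv.Perm (Fin n)) : h.extend (σ • T) = stdHom n σ • h.extend T := by
  refine Equiv.symm_bijective.injective (Equiv.ext fun x => Subtype.ext ?_)
  change (h.extendBox (σ • T) x).1 = (h.extendBox T ((stdHom n σ)⁻¹ x)).1
  rw [← map_inv]
  induction x using Fin.lastCases with
  | last => rw [stdHom_last, extendBox_last, extendBox_last]
  | cast x =>
    rw [stdHom_castSucc, extendBox_castSucc, extendBox_castSucc]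
    rfl

include T in
theorem exists_extend_eq {S : Tableau μ' (n + 1)} (hS : (S.symm (Fin.last n)).1 = c₀) :
    ∃ T, h.extend T = S := by
  obtain ⟨σ, rfl⟩ := (h.extend T).exists_smul_eq S
  have inv_last : σ⁻¹ (Fin.last n) = Fin.last n :=
    (h.extend T).symm.injective (Subtype.ext (hS.trans (h.extend_symm_last T).symm))
  obtain ⟨τ, rfl⟩ := exists_stdHom_eq (Equiv.Perm.inv_eq_iff_eq.1 inv_last).symm
  exact ⟨τ • T, h.extend_smul T τ⟩

variable {T}

theorem stdHom_mem_colStab {q : Equiv.Perm (Fin n)} :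
    stdHom n q ∈ (h.extend T).colStab ↔ q ∈ T.colStab := by
  rw [Tableau.mem_colStab, Tableau.mem_colStab, Fin.forall_fin_succ']
  simp only [stdHom_castSucc, stdHom_last, colOf_extend_castSucc, and_true]

theorem stdHom_mem_rowStab {π : Equiv.Perm (Fin n)} :
    stdHom n π ∈ (h.extend T).rowStab ↔ π ∈ T.rowStab := by
  rw [Tableau.mem_rowStab, Tableau.mem_rowStab, Fin.forall_fin_succ']
  simp only [stdHom_castSucc, stdHom_last, rowOf_extend_castSucc, and_true]

theorem apply_last_of_mem_colStab {q : Equiv.Perm (Fin (n + 1))}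
    (hq : q ∈ (h.extend T).colStab) : q (Fin.last n) = Fin.last n := by
  refine (h.extend T).symm.injective (Subtype.ext ?_)
  rw [extend_symm_last]
  exact h.eq_of_col_eq (Subtype.prop _) ((hq _).trans (h.colOf_extend_last T))

variable (T)

theorem map_stdHom_colStab_bijective : Function.Bijective
    (Subtype.map (stdHom n) fun _ => h.stdHom_mem_colStab.2 : T.colStab → (h.extend T).colStab) :=
  ⟨Subtype.map_injective _ (stdHom_injective n), fun q => by
    obtain ⟨p, hp⟩ := exists_stdHom_eq (h.apply_last_of_mem_colStab q.2)
    exact ⟨⟨p, h.stdHom_mem_colStab.1 (hp ▸ q.2)⟩, Subtype.ext hp⟩⟩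

/-- The labels of `extend` in the row of the new box. -/
noncomputable def newRow : Finset (Fin (n + 1)) := {i | (h.extend T).rowOf i = c₀.1}

theorem last_mem_newRow : Fin.last n ∈ h.newRow T :=
  (Finset.mem_filter_univ _).2 (h.rowOf_extend_last T)

variable {T} in
theorem swap_last_mem_rowStab {i : Fin (n + 1)} (hi : i ∈ h.newRow T) :
    Equiv.swap i (Fin.last n) ∈ (h.extend T).rowStab :=
  Tableau.swap_mem_rowStab (((Finset.mem_filter_univ i).1 hi).trans (h.rowOf_extend_last T).symm)

/-- The row stabilizer of `T` inside that of `extend`, with the coset representatives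
`(i n+1)`. -/
noncomputable def rowCoset (p : h.newRow T × T.rowStab) : (h.extend T).rowStab :=
  ⟨Equiv.swap p.1.1 (Fin.last n) * stdHom n p.2,
    mul_mem (h.swap_last_mem_rowStab p.1.2) (h.stdHom_mem_rowStab.2 p.2.2)⟩

theorem rowCoset_apply_last (p : h.newRow T × T.rowStab) :
    (h.rowCoset T p).1 (Fin.last n) = p.1 := by
  rw [rowCoset, Equiv.Perm.mul_apply, stdHom_last, Equiv.swap_apply_right]

theorem rowCoset_bijective : Function.Bijective (h.rowCoset T) := by
  refine ⟨?_, fun σ => ?_⟩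
  · rintro ⟨i, π⟩ ⟨j, π'⟩ hij
    obtain rfl : i = j := Subtype.ext <| by
      rw [← h.rowCoset_apply_last T (i, π), hij, rowCoset_apply_last]
    exact Prod.ext rfl (Subtype.ext (stdHom_injective n
      (mul_left_cancel (congrArg Subtype.val hij))))
  · have apply_last_mem : σ.1 (Fin.last n) ∈ h.newRow T := (Finset.mem_filter_univ _).2
      ((Tableau.mem_rowStab.1 σ.2 _).trans (h.rowOf_extend_last T))
    obtain ⟨π, hπ⟩ := exists_stdHom_eq
      (σ := Equiv.swap (σ.1 (Fin.last n)) (Fin.last n) * σ.1) (Equiv.swap_apply_left _ _)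
    refine ⟨(⟨_, apply_last_mem⟩, ⟨π, h.stdHom_mem_rowStab.1 ?_⟩), Subtype.ext ?_⟩
    · rw [hπ]
      exact mul_mem (h.swap_last_mem_rowStab apply_last_mem) σ.2
    · refine (congrArg (Equiv.swap (σ.1 (Fin.last n)) (Fin.last n) * ·) hπ).trans ?_
      rw [← mul_assoc, Equiv.swap_mul_self, one_mul]

end Tableaux

section Symmetrizers

variable {X X' : Type*} [AddCommGroup X] [Module ℚ X] [AddCommGroup X'] [Module ℚ X']
  {ρ : Representation ℚ (Equiv.Perm (Fin n)) X}
  {ρ' : Representation ℚ (Equiv.Perm (Fin (n + 1))) X'}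
  (ι : IntertwiningMap ρ (ρ'.comp (stdHom n)))

theorem colSym_extend (x : X) : colSym (h.extend T) ρ' (ι x) = ι (colSym T ρ x) := by
  rw [symmetrizer_apply, symmetrizer_apply, map_sum]
  refine (Fintype.sum_bijective _ (h.map_stdHom_colStab_bijective T) _ _ fun q => ?_).symm
  rw [Subtype.map_coe, sign_stdHom, Units.smul_def, Units.smul_def, map_zsmul,
    IntertwiningMap.isIntertwining]
  rfl

theorem rowSym_extend (x : X) :
    rowSym (h.extend T) ρ' (ι x) =
      swapSum ρ' ι.toLinearMap (h.newRow T) (rowSym T ρ x) := by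
  rw [swapSum, LinearMap.sum_apply, ← Finset.sum_coe_sort, symmetrizer_apply, symmetrizer_apply,
    ← (h.rowCoset_bijective T).sum_comp, Fintype.sum_prod_type]
  refine Finset.sum_congr rfl fun i _ => ?_
  rw [map_sum]
  refine Finset.sum_congr rfl fun π _ => ?_
  rw [MonoidHom.one_apply, one_smul, MonoidHom.one_apply, one_smul, rowCoset, map_mul,
    LinearMap.comp_apply, IntertwiningMap.toLinearMap_apply, IntertwiningMap.isIntertwining]
  rfl

/-- The map `Hom(S^μ, X) → Hom(S^μ', X')` induced by a map of representations `ι : X → X'` along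
`S_n → S_{n+1}`: it sends `f` to the map with `v_{T'} ↦ C' R' ι(f(v_T))`, where `T'` extends `T`
and `R'`, `C'` are the row and column symmetrizers of `T'`. -/
noncomputable def extendHom :
    IntertwiningMap (spechtRep μ n) ρ →ₗ[ℚ] IntertwiningMap (spechtRep μ' (n + 1)) ρ' where
  toFun f := spechtLift (h.extend T) ρ' (ι (f (spechtVec T)))
  map_add' f g := by simp
  map_smul' c f := by simp

theorem extendHom_spechtVec (f : IntertwiningMap (spechtRep μ n) ρ) :
    h.extendHom T ι f (spechtVec (h.extend T)) =
      colSym (h.extend T) ρ' (rowSym (h.extend T) ρ' (ι (f (spechtVec T)))) :=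
  spechtLift_spechtVec ..

theorem extendHom_range_le (f : IntertwiningMap (spechtRep μ n) ρ) {W : Subrepresentation ρ}
    (hf : f.range ≤ W) : (h.extendHom T ι f).range ≤ groupSpan ρ' (ι '' W) := by
  have mem_image : ι (f (spechtVec T)) ∈ ι '' W := ⟨_, hf ⟨spechtVec T, rfl⟩, rfl⟩
  refine spechtLift_range_le _ _ (Submodule.subset_span ⟨1, _, mem_image, ?_⟩)
  rw [map_one, Module.End.one_apply]

theorem colSym_extend_apply_spechtVec (f : IntertwiningMap (spechtRep μ n) ρ) :
    colSym (h.extend T) ρ' (ι (f (spechtVec T))) =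
      Fintype.card T.colStab • ι (f (spechtVec T)) := by
  rw [colSym_extend, ← map_symmetrizer, colSym_spechtVec, map_nsmul, map_nsmul]

/-- As `ι(f(v_T))` is a multiple of its image under `C'`, the vanishing of `C' R' ι(f(v_T))`
entails that of `R' ι(f(v_T))`, which is the sum of the transposes `(i n+1) ι(f(R v_T))`. -/
theorem extendHom_injective [FiniteDimensional ℚ X']
    (hι : Function.Injective (swapSum ρ' ι.toLinearMap (h.newRow T))) :
    Function.Injective (h.extendHom T ι) := by
  refine (injective_iff_map_eq_zero _).2 fun f hf => ?_
  have card_ne_zero : (Fintype.card T.colStab : ℚ) ≠ 0 := Nat.cast_ne_zero.2 Fintype.card_ne_zero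
  have colSym_rowSym :
      colSym (h.extend T) ρ' (rowSym (h.extend T) ρ' (ι (f (spechtVec T)))) = 0 := by
    rw [← extendHom_spechtVec, hf]
    rfl
  have rowSym_colSym := symmetrizer_symmetrizer_eq_zero ρ' (H := (h.extend T).rowStab)
    (K := (h.extend T).colStab) 1 Equiv.Perm.sign (x := ι (f (spechtVec T))) <| by
      rw [colSym_extend_apply_spechtVec, map_nsmul, map_nsmul, colSym_rowSym, smul_zero]
  rw [colSym_extend_apply_spechtVec, map_nsmul, ← Nat.cast_smul_eq_nsmul ℚ,
    smul_eq_zero_iff_right card_ne_zero, rowSym_extend, ← map_symmetrizer,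
    map_eq_zero_iff _ hι] at rowSym_colSym
  have := isIrreducible_spechtRep (T := T)
  refine (IsIrreducible.injective_or_eq_zero f).resolve_left fun hf => ?_
  exact rowSym_spechtVec_ne_zero T ((map_eq_zero_iff f hf).1 rowSym_colSym)

end Symmetrizers

section SpechtMap

/-- The map of tabloids that puts the new label into the row of the new box. -/
noncomputable def tabloidExtend : Tabloid μ n → Tabloid μ' (n + 1) :=
  Quotient.map h.extend fun T S (hTS : ∀ x, T.rowOf x = S.rowOf x) x => by
    induction x using Fin.lastCases with
    | last => rw [rowOf_extend_last, rowOf_extend_last]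
    | cast x => rw [rowOf_extend_castSucc, rowOf_extend_castSucc, hTS x]

theorem tabloidExtend_smul (σ : Equiv.Perm (Fin n)) (t : Tabloid μ n) :
    h.tabloidExtend (σ • t) = stdHom n σ • h.tabloidExtend t := by
  induction t using Quotient.inductionOn with | h T => ?_
  exact congrArg Tabloid.mk (h.extend_smul T σ)

/-- The map `M^μ → M^μ'` that extends tabloids, as a map of representations of `S_n`. -/
noncomputable def tabloidMap :
    IntertwiningMap (tabloidRep μ n) ((tabloidRep μ' (n + 1)).comp (stdHom n)) :=
  ⟨MonoidAlgebra.mapDomainLinearMap ℚ ℚ h.tabloidExtend, fun σ =>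
    (MonoidAlgebra.basis (Tabloid μ n) ℚ).ext fun t => by simp [tabloidExtend_smul]⟩

theorem tabloidMap_polytabloid : h.tabloidMap (polytabloid T) = polytabloid (h.extend T) := by
  rw [polytabloid_eq_colSym, polytabloid_eq_colSym, ← h.colSym_extend T h.tabloidMap]
  congr 1
  exact MonoidAlgebra.mapDomain_single

/-- The map of Specht modules that extends polytabloids, as a map of representations of `S_n`. -/
noncomputable def spechtMap :
    IntertwiningMap (spechtRep μ n) ((spechtRep μ' (n + 1)).comp (stdHom n)) :=
  ⟨h.tabloidMap.toLinearMap.restrict (p := (specht μ n).toSubmodule)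
      (q := (specht μ' (n + 1)).toSubmodule) fun v hv => by
    suffices (specht μ n).toSubmodule ≤ (specht μ' (n + 1)).toSubmodule.comap
      h.tabloidMap.toLinearMap from this hv
    refine Submodule.span_le.2 ?_
    rintro _ ⟨T, rfl⟩
    exact Submodule.subset_span ⟨h.extend T, (h.tabloidMap_polytabloid T).symm⟩,
    fun σ => LinearMap.ext fun v =>
      Subtype.ext (h.tabloidMap.isIntertwining _ _ σ v.1)⟩

theorem spechtMap_spechtVec : h.spechtMap (spechtVec T) = spechtVec (h.extend T) :=
  Subtype.ext (h.tabloidMap_polytabloid T)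

end SpechtMap

end AddsColumn

section Relations

variable {μ : YoungDiagram} {n : ℕ} {T : Tableau μ n}

theorem spechtVec_swap_of_colOf_eq {x y : Fin n} (hxy : x ≠ y) (h : T.colOf x = T.colOf y) :
    spechtVec (Equiv.swap x y • T) = -spechtVec T := by
  apply Subtype.ext
  change polytabloid (Equiv.swap x y • T) = -polytabloid T
  rw [← tabloidRep_polytabloid, polytabloid_eq_colSym,
    apply_symmetrizer_of_mem _ _ (Tableau.swap_mem_colStab h), Equiv.Perm.sign_swap hxy,
    Units.neg_smul, one_smul]

theorem Tableau.rowOf_smul_eq_of_mem_colStab {q : Equiv.Perm (Fin n)} (hq : q ∈ T.colStab)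
    {x : Fin n} (hx : ∀ z, T.colOf z = T.colOf x → z = x) : (q • T).rowOf x = T.rowOf x := by
  rw [Tableau.rowOf_smul, hx _ (T.colStab.inv_mem hq x)]

theorem spechtVec_swap_of_alone {x y : Fin n} (hx : ∀ z, T.colOf z = T.colOf x → z = x)
    (hy : ∀ z, T.colOf z = T.colOf y → z = y) (h : T.rowOf x = T.rowOf y) :
    spechtVec (Equiv.swap x y • T) = spechtVec T := by
  apply Subtype.ext
  change polytabloid (Equiv.swap x y • T) = polytabloid T
  rw [← tabloidRep_polytabloid, polytabloid, map_sum]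
  refine Finset.sum_congr rfl fun q _ => ?_
  have swap_mem : Equiv.swap x y ∈ (q.1 • T).rowStab := Tableau.swap_mem_rowStab <| by
    rw [Tableau.rowOf_smul_eq_of_mem_colStab q.2 hx, Tableau.rowOf_smul_eq_of_mem_colStab q.2 hy, h]
  rw [ofMulAction_single, MulAction.mem_stabilizer_iff.1 swap_mem]

end Relations

section Padded

variable {lam : YoungDiagram} {n : ℕ} (h : IsPaddable lam n)

theorem zero_mem_padded {j : ℕ} : (0, j) ∈ padded lam n h ↔ j < n - lam.card := by
  simp [padded, YoungDiagram.mem_ofRowLens]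

theorem succ_mem_padded {i j : ℕ} : (i + 1, j) ∈ padded lam n h ↔ (i, j) ∈ lam := by
  conv_rhs => rw [← YoungDiagram.ofRowLens_to_rowLens_eq_self (μ := lam)]
  simp [padded, YoungDiagram.mem_ofRowLens]

theorem row_eq_zero_of_mem_padded {c : ℕ × ℕ} (hc : c ∈ padded lam n h)
    (hcol : lam.rowLen 0 ≤ c.2) : c.1 = 0 := by
  obtain ⟨_ | i, j⟩ := c
  · rfl
  · rw [succ_mem_padded, YoungDiagram.mem_iff_lt_rowLen] at hc
    exact absurd (hc.trans_le (lam.rowLen_anti 0 i i.zero_le)) hcol.not_gt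

theorem col_lt_of_mem_padded {c : ℕ × ℕ} (hc : c ∈ padded lam n h) : c.2 < n - lam.card := by
  rcases lt_or_ge c.2 (lam.rowLen 0) with hcol | hcol
  · exact hcol.trans_le (Nat.le_sub_of_add_le' h)
  · refine (zero_mem_padded h).1 ?_
    rwa [← row_eq_zero_of_mem_padded h hc hcol]

theorem addsColumn_padded :
    AddsColumn (padded lam n h) (padded lam (n + 1) h.succ) (0, n - lam.card) where
  cells_eq := by
    have card_le : lam.card ≤ n := le_of_add_le_left h
    ext ⟨_ | i, j⟩
    · rw [Finset.mem_insert, YoungDiagram.mem_cells, YoungDiagram.mem_cells, zero_mem_padded,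
        zero_mem_padded, Prod.mk.injEq]
      omega
    · rw [Finset.mem_insert, YoungDiagram.mem_cells, YoungDiagram.mem_cells, succ_mem_padded,
        succ_mem_padded]
      simp
  col_ne c hc := (col_lt_of_mem_padded h hc).ne

theorem cells_padded : (padded lam n h).cells =
    (Finset.range (n - lam.card)).image (fun j => (0, j)) ∪
      lam.cells.image (Prod.map Nat.succ id) := by
  ext ⟨_ | i, j⟩
  · rw [YoungDiagram.mem_cells, zero_mem_padded]
    simp
  · rw [YoungDiagram.mem_cells, succ_mem_padded]
    simp

theorem card_padded : (padded lam n h).card = n := by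
  rw [YoungDiagram.card, cells_padded, Finset.card_union_of_disjoint,
    Finset.card_image_of_injective _ (Prod.mk_right_injective 0), Finset.card_range,
    Finset.card_image_of_injective _ (Nat.succ_injective.prodMap Function.injective_id)]
  · exact Nat.sub_add_cancel (le_of_add_le_left h)
  · simp [Finset.disjoint_left]

theorem nonempty_tableau_padded : Nonempty (Tableau (padded lam n h) n) :=
  ⟨Finset.equivFinOfCardEq (card_padded h)⟩

theorem rowLen_zero_le_card (lam : YoungDiagram) : lam.rowLen 0 ≤ lam.card := by
  rw [YoungDiagram.rowLen_eq_card]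
  exact Finset.card_le_card (Finset.filter_subset _ _)

variable {h} in
theorem eq_of_colOf_padded_eq {T : Tableau (padded lam n h) n} {x y : Fin n}
    (hx : lam.rowLen 0 ≤ T.colOf x) (hxy : T.colOf y = T.colOf x) : y = x := by
  refine T.symm.injective (Subtype.ext (Prod.ext ?_ hxy))
  rw [row_eq_zero_of_mem_padded h (T.symm x).2 hx,
    row_eq_zero_of_mem_padded h (T.symm y).2 (hx.trans_eq hxy.symm)]

/-- The box of `n+1` is alone in its column and in the first row, hence exchanging `n+1` with the
label of the box added to `lam[n]` does not change the polytabloid. -/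
theorem spechtVec_mem_range_spechtMap {T : Tableau (padded lam (n + 1) h.succ) (n + 1)}
    (hT : lam.rowLen 0 ≤ T.colOf (Fin.last n)) :
    ∃ S : Tableau (padded lam n h) n, (addsColumn_padded h).spechtMap (spechtVec S) =
      spechtVec T := by
  obtain ⟨T₀⟩ := nonempty_tableau_padded h
  let y := T ⟨_, (addsColumn_padded h).newBox_mem⟩
  have symm_y : (T.symm y).1 = (0, n - lam.card) := congrArg Subtype.val (T.symm_apply_apply _)
  have hy : lam.rowLen 0 ≤ T.colOf y :=
    (Nat.le_sub_of_add_le' h).trans_eq (congrArg Prod.snd symm_y).symm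
  obtain ⟨S, hS⟩ := (addsColumn_padded h).exists_extend_eq T₀
    (S := Equiv.swap y (Fin.last n) • T) <| by
      refine Eq.trans (congrArg (fun x => (T.symm x).1) ?_) symm_y
      exact Equiv.swap_apply_right _ _
  refine ⟨S, ?_⟩
  rw [AddsColumn.spechtMap_spechtVec, hS]
  refine spechtVec_swap_of_alone (fun _ => eq_of_colOf_padded_eq hy)
    (fun _ => eq_of_colOf_padded_eq hT) ?_
  exact (row_eq_zero_of_mem_padded h.succ (T.symm y).2 hy).trans
    (row_eq_zero_of_mem_padded h.succ (T.symm (Fin.last n)).2 hT).symm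

end Padded

section Invariant

variable {k n : ℕ} {V X : Type*} [AddCommGroup V] [Module ℚ V] [AddCommGroup X] [Module ℚ X]

/-- The map `ψ` is invariant under the permutations that fix the first `k` letters. -/
def IsLastInvariant (k : ℕ) (τ : Representation ℚ (Equiv.Perm (Fin n)) X) (ψ : X →ₗ[ℚ] V) : Prop :=
  ∀ σ : Equiv.Perm (Fin n), (∀ i : Fin n, (i : ℕ) < k → σ i = i) → ∀ x, ψ (τ σ x) = ψ x

theorem IsLastInvariant.apply_swap {τ : Representation ℚ (Equiv.Perm (Fin n)) X} {ψ : X →ₗ[ℚ] V}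
    (hψ : IsLastInvariant k τ ψ) {i j : Fin n} (hi : k ≤ (i : ℕ)) (hj : k ≤ (j : ℕ)) (x : X) :
    ψ (τ (Equiv.swap i j) x) = ψ x := by
  refine hψ _ (fun l hl => Equiv.swap_apply_of_ne_of_ne ?_ ?_) x
  · exact fun h => hl.not_ge (h ▸ hi)
  · exact fun h => hl.not_ge (h ▸ hj)

variable {μ : YoungDiagram} {ψ : (specht μ n).toSubmodule →ₗ[ℚ] V}

theorem apply_spechtVec_eq_zero_of_colOf_eq (hψ : IsLastInvariant k (spechtRep μ n) ψ)
    {T : Tableau μ n} {x y : Fin n} (hxy : x ≠ y) (hx : k ≤ (x : ℕ)) (hy : k ≤ (y : ℕ))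
    (h : T.colOf x = T.colOf y) : ψ (spechtVec T) = 0 := by
  have apply_eq_neg := hψ.apply_swap hx hy (spechtVec T)
  rw [spechtRep_spechtVec, spechtVec_swap_of_colOf_eq hxy h, map_neg] at apply_eq_neg
  have := IsAddTorsionFree.of_module_rat (M := V)
  exact self_eq_neg.1 apply_eq_neg.symm

theorem apply_spechtVec_eq_zero_of_colOf_lt (hψ : IsLastInvariant k (spechtRep μ n) ψ)
    {T : Tableau μ n} {b : ℕ} (hb : k + b < n) (h : ∀ x : Fin n, k ≤ (x : ℕ) → T.colOf x < b) :
    ψ (spechtVec T) = 0 := by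
  have last_ge (x : Fin (n - k)) : k ≤ ((x.natAdd k).cast (by omega) : Fin n).1 := by simp
  obtain ⟨x, -, y, -, hxy, hcol⟩ := Finset.exists_ne_map_eq_of_card_lt_of_maps_to
    (s := (Finset.univ : Finset (Fin (n - k)))) (t := Finset.range b)
    (f := fun x => T.colOf ((x.natAdd k).cast (by omega)))
    (by rw [Finset.card_range, Finset.card_univ, Fintype.card_fin]; omega)
    fun x _ => Finset.mem_coe.2 (Finset.mem_range.2 (h _ (last_ge x)))
  refine apply_spechtVec_eq_zero_of_colOf_eq hψ (fun hxy' => hxy ?_) (last_ge x) (last_ge y) hcol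
  exact Fin.natAdd_injective _ k (Fin.cast_injective _ hxy')

theorem IsLastInvariant.eq_zero_of_lt_card {lam : YoungDiagram} (h : IsPaddable lam n)
    {ψ : (specht (padded lam n h) n).toSubmodule →ₗ[ℚ] V}
    (hψ : IsLastInvariant k (spechtRep (padded lam n h) n) ψ) (hk : k < lam.card) : ψ = 0 := by
  have card_le : lam.card ≤ n := le_of_add_le_left h
  refine LinearMap.ext_on_range span_range_spechtVec fun T => ?_
  exact apply_spechtVec_eq_zero_of_colOf_lt hψ (b := n - lam.card) (by omega)
    fun x _ => col_lt_of_mem_padded h (T.symm x).2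

/-- Either all letters after the first `k` lie in the first `lam.rowLen 0` columns, so that two of
them share a column, or one of them, which may be moved to `n+1`, lies beyond. -/
theorem IsLastInvariant.eq_zero_of_comp_spechtMap_eq_zero {lam : YoungDiagram}
    (h : IsPaddable lam n) (hn : k + lam.rowLen 0 ≤ n)
    {ψ : (specht (padded lam (n + 1) h.succ) (n + 1)).toSubmodule →ₗ[ℚ] V}
    (hψ : IsLastInvariant k (spechtRep (padded lam (n + 1) h.succ) (n + 1)) ψ)
    (h_comp : ∀ x, ψ ((addsColumn_padded h).spechtMap x) = 0) : ψ = 0 := by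
  refine LinearMap.ext_on_range span_range_spechtVec fun T => ?_
  by_cases hT : ∀ x : Fin (n + 1), k ≤ (x : ℕ) → T.colOf x < lam.rowLen 0
  · exact apply_spechtVec_eq_zero_of_colOf_lt hψ (Nat.lt_succ_of_le hn) hT
  · push Not at hT
    obtain ⟨x, hkx, hx⟩ := hT
    have last_ge : k ≤ (Fin.last n : ℕ) := le_of_add_le_left hn
    obtain ⟨S, hS⟩ := spechtVec_mem_range_spechtMap h
      (T := Equiv.swap x (Fin.last n) • T) (hx.trans_eq (congrArg T.colOf
        (Equiv.swap_apply_right x (Fin.last n)).symm))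
    rw [← hψ.apply_swap hkx last_ge, spechtRep_spechtVec, ← hS, h_comp, LinearMap.zero_apply]

end Invariant

section Multiplicities

variable {k : ℕ} {V : Type u} [AddCommGroup V] [Module ℚ V]
  (ρ : Representation ℚ (Equiv.Perm (Fin k)) V) {ℓ : ℕ}

theorem isLastInvariant_youngProj_comp {X : Type*} [AddCommGroup X] [Module ℚ X]
    {τ : Representation ℚ (Equiv.Perm (Fin (k + ℓ))) X} (f : IntertwiningMap τ (indRep ρ ℓ)) :
    IsLastInvariant k τ (youngProj ρ ℓ ∘ₗ f.toLinearMap) := by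
  intro σ hσ x
  obtain ⟨g, rfl⟩ := exists_youngHom_one_eq hσ
  rw [LinearMap.comp_apply, LinearMap.comp_apply, IntertwiningMap.toLinearMap_apply,
    IntertwiningMap.isIntertwining, indProj_ind_map, MonoidHom.comp_apply, MonoidHom.coe_fst,
    map_one, Module.End.one_apply, IntertwiningMap.toLinearMap_apply]

theorem eq_zero_of_youngProj_comp_eq_zero {X : Type*} [AddCommGroup X] [Module ℚ X]
    {τ : Representation ℚ (Equiv.Perm (Fin (k + ℓ))) X} {f : IntertwiningMap τ (indRep ρ ℓ)}
    (hf : youngProj ρ ℓ ∘ₗ f.toLinearMap = 0) : f = 0 :=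
  (LinearEquiv.map_eq_zero_iff (frobenius (youngHom_injective k ℓ) τ (boxTrivial ρ ℓ))).1
    (IntertwiningMap.ext hf)

/-- The map `Hom(X', I_{n+1}(V)) → Hom(X, I_n(V))` induced by a map of representations `X → X'`
along `S_n → S_{n+1}`: by Frobenius reciprocity, it corresponds to composition with `X → X'`. -/
noncomputable def restrictHom {X X' : Type*} [AddCommGroup X] [Module ℚ X] [AddCommGroup X']
    [Module ℚ X'] {τ : Representation ℚ (Equiv.Perm (Fin (k + ℓ))) X}
    {τ' : Representation ℚ (Equiv.Perm (Fin (k + (ℓ + 1)))) X'}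
    (j : IntertwiningMap τ (τ'.comp (stdHom (k + ℓ)))) :
    IntertwiningMap τ' (indRep ρ (ℓ + 1)) →ₗ[ℚ] IntertwiningMap τ (indRep ρ ℓ) :=
  (frobenius (youngHom_injective k ℓ) τ (boxTrivial ρ ℓ)).symm.toLinearMap ∘ₗ
    { toFun := fun f => ⟨youngProj ρ (ℓ + 1) ∘ₗ f.toLinearMap ∘ₗ j.toLinearMap, fun g =>
        LinearMap.ext fun x => by
          have map_j : j (τ (youngHom k ℓ g) x) =
              τ' (youngHom k (ℓ + 1) (g.1, stdHom ℓ g.2)) (j x) := by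
            rw [j.isIntertwining, youngHom_stdHom]
            rfl
          exact (congrArg (fun y => youngProj ρ (ℓ + 1) (f y)) map_j).trans
            ((congrArg _ (f.isIntertwining _ _ _ _)).trans (indProj_ind_map _ _ _ _))⟩
      map_add' := fun f f' => by ext; simp
      map_smul' := fun c f => by ext; simp }

theorem youngProj_comp_eq_zero_of_restrictHom_eq_zero {X X' : Type*} [AddCommGroup X] [Module ℚ X]
    [AddCommGroup X'] [Module ℚ X'] {τ : Representation ℚ (Equiv.Perm (Fin (k + ℓ))) X}
    {τ' : Representation ℚ (Equiv.Perm (Fin (k + (ℓ + 1)))) X'}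
    {j : IntertwiningMap τ (τ'.comp (stdHom (k + ℓ)))}
    {f : IntertwiningMap τ' (indRep ρ (ℓ + 1))} (hf : restrictHom ρ j f = 0) (x : X) :
    youngProj ρ (ℓ + 1) (f (j x)) = 0 :=
  congrArg (fun g : IntertwiningMap (τ.comp (youngHom k ℓ)) (boxTrivial ρ ℓ) => g x)
    ((LinearEquiv.map_eq_zero_iff
      (frobenius (youngHom_injective k ℓ) τ (boxTrivial ρ ℓ)).symm).1 hf)

variable {lam : YoungDiagram} (h : IsPaddable lam (k + ℓ))

theorem restrictHom_spechtMap_injective (hℓ : lam.rowLen 0 ≤ ℓ) :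
    Function.Injective
      (restrictHom ρ (ℓ := ℓ) ((addsColumn_padded h).spechtMap (n := k + ℓ))) := by
  refine (injective_iff_map_eq_zero _).2 fun f hf =>
    eq_zero_of_youngProj_comp_eq_zero ρ (ℓ := ℓ + 1) ?_
  exact (isLastInvariant_youngProj_comp ρ (ℓ := ℓ + 1) f).eq_zero_of_comp_spechtMap_eq_zero h
    (Nat.add_le_add_left hℓ k) (youngProj_comp_eq_zero_of_restrictHom_eq_zero ρ hf)

instance isIrreducible_stableIrrep {n : ℕ} (h : IsPaddable lam n) :
    IsIrreducible (stableIrrep lam n h) := by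
  obtain ⟨T⟩ := nonempty_tableau_padded h
  exact isIrreducible_spechtRep (T := T)

theorem finrank_intertwiningMap_stableIrrep {n : ℕ} (h : IsPaddable lam n) :
    finrank ℚ (IntertwiningMap (stableIrrep lam n h) (stableIrrep lam n h)) = 1 := by
  obtain ⟨T⟩ := nonempty_tableau_padded h
  exact finrank_intertwiningMap_spechtRep (T := T)

/-- The map `Hom(V(lam)_n, I_n(V)) → Hom(V(lam)_{n+1}, I_{n+1}(V))` induced by `ι_n`, which depends
on the choice of a tableau. -/
noncomputable def extendStableHom (T : Tableau (padded lam (k + ℓ) h) (k + ℓ)) :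
    IntertwiningMap (stableIrrep lam (k + ℓ) h) (indRep ρ ℓ) →ₗ[ℚ]
      IntertwiningMap (stableIrrep lam (k + (ℓ + 1)) h.succ) (indRep ρ (ℓ + 1)) :=
  (addsColumn_padded h).extendHom T (indInclusionHom ρ ℓ)

variable [FiniteDimensional ℚ V]

theorem extendStableHom_injective (T : Tableau (padded lam (k + ℓ) h) (k + ℓ)) :
    Function.Injective (extendStableHom ρ h T) :=
  (addsColumn_padded h).extendHom_injective (X' := IndSpace ρ (ℓ + 1)) T (indInclusionHom ρ ℓ)
    (swapSum_indInclusion_injective ρ ℓ ((addsColumn_padded h).last_mem_newRow T))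

theorem inducedSequence_isMonotone : (inducedSequence ρ).IsMonotone k := by
  intro ℓ _ lam h m W hW
  have : Nontrivial (specht (padded lam (k + ℓ) h) (k + ℓ)).toSubmodule :=
    IsSimpleModule.nontrivial ℚ[Equiv.Perm (Fin (k + ℓ))] (stableIrrep lam (k + ℓ) h).asModule
  obtain ⟨f, hf, range_le⟩ := hW.exists_linearIndependent
  obtain ⟨T⟩ := nonempty_tableau_padded h
  exact exists_isCopies_of_linearIndependent (finrank_intertwiningMap_stableIrrep h.succ)
    (hf.map' _ (LinearMap.ker_eq_bot.2 (extendStableHom_injective ρ h T)))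
    fun i => (addsColumn_padded h).extendHom_range_le T (indInclusionHom ρ ℓ) (f i) (range_le i)

theorem mult_eq_finrank : (inducedSequence ρ).mult lam ℓ =
    finrank ℚ (IntertwiningMap (stableIrrep lam (k + ℓ) h) (indRep ρ ℓ)) := by
  rw [ConsistentSequence.mult, dif_pos h]
  exact multiplicity_eq_finrank (finrank_intertwiningMap_stableIrrep h)

theorem mult_eq_zero_of_lt_card (hk : k < lam.card) (ℓ : ℕ) :
    (inducedSequence ρ).mult lam ℓ = 0 := by
  by_cases h : IsPaddable lam (k + ℓ)
  · have : Subsingleton (IntertwiningMap (stableIrrep lam (k + ℓ) h) (indRep ρ ℓ)) :=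
      subsingleton_of_forall_eq 0 fun f => eq_zero_of_youngProj_comp_eq_zero ρ
        ((isLastInvariant_youngProj_comp ρ f).eq_zero_of_lt_card h hk)
    rw [mult_eq_finrank ρ h, finrank_zero_of_subsingleton, Nat.cast_zero]
  · rw [ConsistentSequence.mult, dif_neg h]

include h in
theorem mult_succ (hℓ : lam.rowLen 0 ≤ ℓ) :
    (inducedSequence ρ).mult lam (ℓ + 1) = (inducedSequence ρ).mult lam ℓ := by
  obtain ⟨T⟩ := nonempty_tableau_padded h
  rw [mult_eq_finrank ρ h, mult_eq_finrank ρ (ℓ := ℓ + 1) h.succ]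
  exact congrArg Nat.cast (le_antisymm
    (LinearMap.finrank_le_finrank_of_injective (restrictHom_spechtMap_injective ρ h hℓ))
    (LinearMap.finrank_le_finrank_of_injective (extendStableHom_injective ρ h T)))

theorem mult_eq_of_le (hk : lam.card ≤ k) (hℓ : k ≤ ℓ) :
    (inducedSequence ρ).mult lam ℓ = (inducedSequence ρ).mult lam k := by
  have rowLen_le : lam.rowLen 0 ≤ k := (rowLen_zero_le_card lam).trans hk
  induction ℓ, hℓ using Nat.le_induction with
  | base => rfl
  | succ ℓ hℓ ih =>
    rw [← ih, mult_succ ρ (add_le_add hk (rowLen_le.trans hℓ)) (rowLen_le.trans hℓ)]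

theorem inducedSequence_isUniformlyRepresentationStable :
    (inducedSequence ρ).IsUniformlyRepresentationStable (2 * k) where
  injectivity ℓ _ := indInclusion_injective ρ ℓ
  surjectivity ℓ _ := by
    rw [ConsistentSequence.spanImage, Submodule.top_coe, Set.image_univ]
    exact groupSpan_range_indInclusion ρ ℓ
  multiplicity_stable lam := by
    rcases lt_or_ge k lam.card with hk | hk
    · exact ⟨0, fun ℓ _ => mult_eq_zero_of_lt_card ρ hk ℓ⟩
    · have h : IsPaddable lam (k + k) := add_le_add hk ((rowLen_zero_le_card lam).trans hk)
      exact ⟨_, fun ℓ hℓ => (mult_eq_of_le ρ hk (by omega)).trans (mult_eq_finrank ρ h)⟩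

end Multiplicities

end RepStability

theorem mainTheorem3 (k : ℕ) {V : Type*} [AddCommGroup V] [Module ℚ V] [FiniteDimensional ℚ V]
    (ρ : Representation ℚ (Equiv.Perm (Fin k)) V) :
    (RepStability.inducedSequence ρ).IsMonotone k ∧
      (RepStability.inducedSequence ρ).IsUniformlyRepresentationStable (2 * k) :=
  ⟨RepStability.inducedSequence_isMonotone ρ,
    RepStability.inducedSequence_isUniformlyRepresentationStable ρ⟩
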